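/- Let $d \geq 2$. A group is nilpotent of class at most $d$ if the $(d+1)$-st term $\gamma_{d+1}$ of its lower central series ($\gamma_1(G) = G$, $\gamma_{i+1}(G) = [\gamma_i(G), G]$) is trivial. Fix a countably infinite set of symbols $X_0$. Let $\mathfrak{N}_d^0$ be the category whose objects are the groups $W(X) = F(X)/\gamma_{d+1}(F(X))$, one for each finite subset $X \subset X_0$ (where $F(X)$ is the free group on $X$), that is, the finitely generated free groups of the variety of nilpotent groups of class at most $d$, and whose morphisms are all the group homomorphisms between them. An automorphism $\Phi$ of a category (a functor from the category to itself with a two-sided inverse functor) is called inner if it is isomorphic, as a functor, to the identity functor: there are isomorphisms $s_A : A \to \Phi(A)$, one for each object $A$, such that $\Phi(\alpha) \circ s_A = s_B \circ \alpha$ for every morphism $\alpha : A \to B$. Then every automorphism of $\mathfrak{N}_d^0$ is inner; that is, $\mathrm{Aut}\,\mathfrak{N}_d^0 = \mathrm{Inn}\,\mathfrak{N}_d^0$, where $\mathrm{Aut}$ denotes the group of all automorphisms of the category and $\mathrm{Inn}$ its subgroup of inner automorphisms. -/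

import Mathlib

open CategoryTheory

/-- The free group of the variety of nilpotent groups of class at most `d` on the set of free
generators `X`: the free group on `X` modulo the `(d + 1)`-st term of its lower central series.
(Mathlib numbers the lower central series from `0`, the term with index `0` being the whole
group.) -/
abbrev FreeNilpotentGroup (d : ℕ) (X : Type) : Type :=
  FreeGroup X ⧸ (⊤ : Subgroup (FreeGroup X)).lowerCentralSeries d

/-- An object of the category of finitely generated free nilpotent groups of class at most `d`:
it is given by a finite subset of a fixed countably infinite set of symbols, here `ℕ`. -/
structure FreeNilpotentCat (d : ℕ) : Type where
  /-- The finite set of free generators. -/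
  gens : Finset ℕ

namespace FreeNilpotentCat

/-- The group belonging to an object, free nilpotent of class at most `d` on its generators. -/
abbrev carrier {d : ℕ} (A : FreeNilpotentCat d) : Type :=
  FreeNilpotentGroup d A.gens

/-- Morphisms are all the group homomorphisms. -/
instance category (d : ℕ) : Category.{0} (FreeNilpotentCat d) where
  Hom A B := A.carrier →* B.carrier
  id A := MonoidHom.id A.carrier
  comp f g := g.comp f

end FreeNilpotentCat

/-- The group of automorphisms of a category `C`: the functors `C ⥤ C` with a two-sided inverse
with respect to composition (equality of functors, not merely isomorphism). -/
abbrev CatAut (C : Type) [Category.{0} C] : Type :=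
  Aut (Cat.of C)

/-- The functor underlying an automorphism of a category. -/
abbrev CatAut.functor {C : Type} [Category.{0} C] (Φ : CatAut C) : C ⥤ C :=
  Φ.hom.toFunctor

/-- An automorphism `Φ` of a category is inner if there are isomorphisms `s A : A ≅ Φ A`, one for
each object `A`, with `Φ(α) ∘ s A = s B ∘ α` for every morphism `α : A ⟶ B`. -/
def CatAut.IsInner {C : Type} [Category.{0} C] (Φ : CatAut C) : Prop :=
  ∃ s : ∀ A : C, A ≅ Φ.functor.obj A,
    ∀ (A B : C) (α : A ⟶ B), (s A).hom ≫ Φ.functor.map α = α ≫ (s B).hom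

theorem CatAut.isInner_iff {C : Type} [Category.{0} C] (Φ : CatAut C) :
    Φ.IsInner ↔ Nonempty (𝟭 C ≅ Φ.functor) := by
  constructor
  · rintro ⟨s, hs⟩
    exact ⟨NatIso.ofComponents s fun {A B} α => (hs A B α).symm⟩
  · rintro ⟨e⟩
    exact ⟨fun A => e.app A, fun A B α => (e.hom.naturality α).symm⟩

/-- The subgroup of inner automorphisms of a category. -/
def CatAut.Inn (C : Type) [Category.{0} C] : Subgroup (CatAut C) where
  carrier := {Φ | Φ.IsInner}
  one_mem' := (CatAut.isInner_iff _).2 ⟨Iso.refl _⟩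
  mul_mem' := by
    intro Φ Ψ hΦ hΨ
    obtain ⟨e⟩ := (CatAut.isInner_iff Φ).1 hΦ
    obtain ⟨f⟩ := (CatAut.isInner_iff Ψ).1 hΨ
    exact (CatAut.isInner_iff _).2
      ⟨e ≪≫ Φ.functor.leftUnitor.symm ≪≫ Functor.isoWhiskerRight f Φ.functor⟩
  inv_mem' := by
    intro Φ hΦ
    obtain ⟨e⟩ := (CatAut.isInner_iff Φ).1 hΦ
    have h : Φ.functor ⋙ Φ.inv.toFunctor = 𝟭 C := congrArg Cat.Hom.toFunctor Φ.hom_inv_id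
    exact (CatAut.isInner_iff _).2
      ⟨(eqToIso h).symm ≪≫ (Functor.isoWhiskerRight e Φ.inv.toFunctor).symm ≪≫
        Φ.inv.toFunctor.leftUnitor⟩

/-! An automorphism Φ preserves the rank of objects, since rank is visible through retracts
(`card_functor_obj`). So Φ fixes the free group on one generator up to isomorphism, and because that
group represents the underlying-set functor there are natural bijections s from A to Φ(A)
(`nonempty_naturalBijection`). The multiplication of Φ(A), pulled back along s, is natural in A and
hence given by a word w(x, y) (`exists_mul_eq`); in the other direction there is a word w'
(`exists_map_mul_eq`). It remains to show that w is xy or yx modulo γ_{d+1}: then s, or s followed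
by inversion, is the required isomorphism with the identity functor.

Write w = xy·v. The unit laws put v in γ_2. Modulo γ_3 one has v = [x,y]^k, and w' has an exponent
k' likewise; since w' undoes w, (2k+1)(2k'+1) = 1, so k is 0 or -1, which gives xy or yx
(`wordDefect_mem_or_swapWord`). After exchanging the letters if necessary, v lies in γ_3, and
associativity pushes it deeper (`IsAssocWord.wordDefect_mem`). If v lies in γ_{m+1} with m ≥ 2, then
modulo γ_{m+2} its values f(a,b) are central and form a 2-cocycle, and squaring both arguments
multiplies f by 2^{m+1}. The cocycle identity makes the antisymmetric part scale by 4, and a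
symmetric cocycle vanishing on the diagonal scale by 2. Both differ from 2^{m+1}, so
torsion-freeness forces f = 0.

Torsion-freeness (`lowerCentralSeries_isIsolated`) comes from Lazard elimination with weighted
generators. Splitting off a generator x₀ of least weight embeds the truncated free group in a
semidirect product of ℤ with a truncated free group on the commutators [y, x₀, …, x₀], which has one
generator fewer of that weight. Repetition pushes all weights past the truncation. In Mathlib's
numbering, term n of the lower central series is γ_{n+1}. -/

open scoped commutatorElement

/-! ### N-series and weighted filtrations of free groups -/

/-- A descending series of subgroups, starting with the whole group, for which commutators add
the indices. -/
structure IsNSeries {G : Type} [Group G] (S : ℕ → Subgroup G) : Prop where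
  zero : S 0 = ⊤
  antitone : Antitone S
  commutator_le : ∀ i j, ⁅S i, S j⁆ ≤ S (i + j)

namespace IsNSeries

variable {G H : Type} [Group G] [Group H] {S : ℕ → Subgroup G}

theorem normal (hS : IsNSeries S) (k : ℕ) : (S k).Normal := by
  have h := hS.commutator_le 0 k
  rw [hS.zero, zero_add] at h
  exact Subgroup.commutator_top_left_le_iff.1 h

theorem commutator_mem (hS : IsNSeries S) {i j : ℕ} {a b : G} (ha : a ∈ S i) (hb : b ∈ S j) :
    ⁅a, b⁆ ∈ S (i + j) :=
  hS.commutator_le i j (Subgroup.commutator_mem_commutator ha hb)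

theorem comap {T : ℕ → Subgroup H} (hT : IsNSeries T) (f : G →* H) :
    IsNSeries fun k => (T k).comap f where
  zero := by simp [hT.zero]
  antitone _ _ hij := Subgroup.comap_mono (hT.antitone hij)
  commutator_le i j := Subgroup.commutator_le.2 fun a ha b hb => by
    rw [Subgroup.mem_comap] at *
    rw [map_commutatorElement]
    exact hT.commutator_mem ha hb

theorem map (hS : IsNSeries S) {f : G →* H} (hf : Function.Surjective f) :
    IsNSeries fun k => (S k).map f where
  zero := by simp [hS.zero, Subgroup.map_top_of_surjective f hf]
  antitone _ _ hij := Subgroup.map_mono (hS.antitone hij)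
  commutator_le i j := by
    rw [← Subgroup.map_commutator]
    exact Subgroup.map_mono (hS.commutator_le i j)

end IsNSeries

/-! ### Near-identity endomorphisms and N-series on semidirect products. -/

section NearIdentity

variable {N : Type} [Group N] {S : ℕ → Subgroup N}

/-- An endomorphism moving each term of a series by elements lying `m` steps deeper. -/
def IsNearId (S : ℕ → Subgroup N) (m : ℕ) (σ : N →* N) : Prop :=
  ∀ k, ∀ h ∈ S k, h⁻¹ * σ h ∈ S (k + m)

variable {m K : ℕ} {σ : N →* N}

theorem IsNearId.map_mem (hS : IsNSeries S) (hσ : IsNearId S m σ) {k : ℕ} {h : N}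
    (hh : h ∈ S k) : σ h ∈ S k := by
  have h1 := mul_mem hh (hS.antitone (Nat.le_add_right k m) (hσ k h hh))
  rwa [mul_inv_cancel_left] at h1

/-- An element h of the kernel satisfies h⁻¹ = h⁻¹ σ(h), so membership in one term forces membership
in a deeper one, down to the trivial term. -/
theorem IsNearId.injective (hS : IsNSeries S) (hK : S K = ⊥) (hm : 1 ≤ m)
    (hσ : IsNearId S m σ) : Function.Injective σ := by
  rw [injective_iff_map_eq_one]
  intro h hh
  have key : ∀ j, h ∈ S j := by
    intro j
    induction j with
    | zero => rw [hS.zero]; trivial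
    | succ j ih =>
      have h1 := hσ j h ih
      rw [hh, mul_one, inv_mem_iff] at h1
      exact hS.antitone (by omega) h1
  simpa [hK] using key K

theorem IsNearId.exists_eq (hS : IsNSeries S) (hK : S K = ⊥) (hm : 1 ≤ m)
    (hσ : IsNearId S m σ) {k : ℕ} {h : N} (hh : h ∈ S k) : ∃ g ∈ S k, σ g = h := by
  -- Successive approximation: h is its own first preimage, and the error σ(h)⁻¹h lies deeper, where
  -- the induction solves for it.
  have key : ∀ j k, K ≤ k + j → ∀ h ∈ S k, ∃ g ∈ S k, σ g = h := by
    intro j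
    induction j with
    | zero =>
      intro k hk h hh
      have h1 : h = 1 := by simpa [hK] using hS.antitone hk hh
      exact ⟨1, one_mem _, by simp [h1]⟩
    | succ j ih =>
      intro k hk h hh
      have h1 : (σ h)⁻¹ * h ∈ S (k + 1) := by
        have h2 := inv_mem (hσ k h hh)
        rw [mul_inv_rev, inv_inv] at h2
        exact hS.antitone (by omega) h2
      obtain ⟨g, hg, hgh⟩ := ih (k + 1) (by omega) _ h1
      exact ⟨h * g, mul_mem hh (hS.antitone (by omega) hg), by rw [map_mul, hgh]; group⟩
  exact key K k (by omega) h hh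

/-- The near-identity automorphisms form a group. -/
def nearIdSubgroup (hS : IsNSeries S) (hK : S K = ⊥) (hm : 1 ≤ m) : Subgroup (MulAut N) where
  carrier := {τ | IsNearId S m τ.toMonoidHom}
  one_mem' := fun k h _ => by simp
  mul_mem' := by
    intro a b ha hb k h hh
    have h1 := hb k h hh
    have h2 := ha k _ (IsNearId.map_mem hS hb hh)
    have h3 := mul_mem h1 h2
    simpa [mul_assoc] using h3
  inv_mem' := by
    intro a ha k h hh
    obtain ⟨g, hg, rfl⟩ := IsNearId.exists_eq hS hK hm ha hh
    have h1 := inv_mem (ha k g hg)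
    simpa using h1

/-- The series on a semidirect product by a group acting by near-identity automorphisms. -/
def semidirectSeries {Q : Type} [CommGroup Q] (hS : IsNSeries S) (m : ℕ) (φ : Q →* MulAut N)
    (hφ : ∀ q, IsNearId S m (φ q).toMonoidHom) (k : ℕ) : Subgroup (N ⋊[φ] Q) where
  carrier := {p | p.left ∈ S k ∧ (k ≤ m ∨ p.right = 1)}
  one_mem' := ⟨one_mem _, Or.inr rfl⟩
  mul_mem' := by
    rintro a b ⟨ha, ha'⟩ ⟨hb, hb'⟩
    refine ⟨mul_mem ha (IsNearId.map_mem hS (hφ _) hb), ?_⟩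
    rcases ha' with h | h
    · exact Or.inl h
    · rcases hb' with h' | h'
      · exact Or.inl h'
      · exact Or.inr (by simp [h, h'])
  inv_mem' := by
    rintro a ⟨ha, ha'⟩
    refine ⟨IsNearId.map_mem hS (hφ _) (inv_mem ha), ?_⟩
    rcases ha' with h | h
    · exact Or.inl h
    · exact Or.inr (by simp [h])

theorem commutator_mem_of_near {M : Subgroup N} [M.Normal] {h h' u u' : N}
    (hu : h⁻¹ * u ∈ M) (hu' : h'⁻¹ * u' ∈ M) (hc : ⁅h, h'⁆ ∈ M) : h * u' * u⁻¹ * h'⁻¹ ∈ M := by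
  rw [← QuotientGroup.eq_one_iff] at hc ⊢
  have e1 : (h : N ⧸ M) = u := (QuotientGroup.eq).2 hu
  have e2 : (h' : N ⧸ M) = u' := (QuotientGroup.eq).2 hu'
  simp only [commutatorElement_def, QuotientGroup.mk_mul, QuotientGroup.mk_inv] at hc ⊢
  rw [← e1, ← e2]
  exact hc

/-- As Q is commutative, commutators lie in N. A nontrivial Q-component in term j means j ≤ m, so
its action moves term i by at least j steps; up to S (i + j) the commutator is that of the
N-components. -/
theorem semidirectSeries_isNSeries {Q : Type} [CommGroup Q] (hS : IsNSeries S) (m : ℕ)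
    (φ : Q →* MulAut N) (hφ : ∀ q, IsNearId S m (φ q).toMonoidHom) :
    IsNSeries (semidirectSeries hS m φ hφ) where
  zero := by
    rw [eq_top_iff]
    intro p _
    exact ⟨by rw [hS.zero]; trivial, Or.inl (Nat.zero_le _)⟩
  antitone i j hij := by
    rintro p ⟨hp, hp'⟩
    exact ⟨hS.antitone hij hp, hp'.imp (fun h => hij.trans h) id⟩
  commutator_le i j := by
    rw [Subgroup.commutator_le]
    rintro a ⟨ha, ha'⟩ b ⟨hb, hb'⟩
    have hright : ⁅a, b⁆.right = 1 := by
      simp [commutatorElement_def, mul_comm a.right b.right]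
    refine ⟨?_, Or.inr hright⟩
    have hleft : ⁅a, b⁆.left = a.left * φ a.right b.left * (φ b.right a.left)⁻¹ * b.left⁻¹ := by
      have e : ⁅a, b⁆ * (b * a) = a * b := by rw [commutatorElement_def]; group
      have e' := congrArg SemidirectProduct.left e
      rw [SemidirectProduct.mul_left, hright, map_one, MulAut.one_apply] at e'
      rw [eq_mul_inv_of_mul_eq e', SemidirectProduct.mul_left, SemidirectProduct.mul_left,
        mul_inv_rev, mul_assoc, mul_assoc, mul_assoc]
    rw [hleft]
    have := hS.normal (i + j)
    refine commutator_mem_of_near ?_ ?_ (hS.commutator_mem ha hb)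
    · rcases hb' with h | h
      · exact hS.antitone (by omega) (hφ b.right i _ ha)
      · simp [h]
    · rcases ha' with h | h
      · exact hS.antitone (by omega) (hφ a.right j _ hb)
      · simp [h]

end NearIdentity

/-! ### The weighted filtration of a free group. -/

/-- The smallest N-series of a free group containing each free generator at its weight. -/
def weightSeries {X : Type} (wt : X → ℕ) (k : ℕ) : Subgroup (FreeGroup X) :=
  ⨅ (S : ℕ → Subgroup (FreeGroup X)) (_ : IsNSeries S ∧ ∀ x, FreeGroup.of x ∈ S (wt x)), S k

section weightSeries

variable {X : Type} {wt : X → ℕ}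

theorem mem_weightSeries {k : ℕ} {g : FreeGroup X} :
    g ∈ weightSeries wt k ↔ ∀ S : ℕ → Subgroup (FreeGroup X), IsNSeries S →
      (∀ x, FreeGroup.of x ∈ S (wt x)) → g ∈ S k := by
  simp only [weightSeries, Subgroup.mem_iInf, and_imp]

theorem weightSeries_isNSeries : IsNSeries (weightSeries wt) where
  zero := by
    rw [eq_top_iff]
    intro g _
    rw [mem_weightSeries]
    intro S hS _
    rw [hS.zero]
    trivial
  antitone i j hij g hg := by
    rw [mem_weightSeries] at *
    exact fun S hS h => hS.antitone hij (hg S hS h)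
  commutator_le i j := Subgroup.commutator_le.2 fun a ha b hb => by
    rw [mem_weightSeries] at *
    exact fun S hS h => hS.commutator_mem (ha S hS h) (hb S hS h)

theorem of_mem_weightSeries (x : X) : FreeGroup.of x ∈ weightSeries wt (wt x) :=
  mem_weightSeries.2 fun _ _ h => h x

instance weightSeries_normal (k : ℕ) : (weightSeries wt k).Normal :=
  weightSeries_isNSeries.normal k

/-- The universal property by which the filtration is used: minimality is tested against the
pullback of an N-series. -/
theorem map_mem_of_mem_weightSeries {G : Type} [Group G] {S : ℕ → Subgroup G} (hS : IsNSeries S)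
    {f : FreeGroup X →* G} (hf : ∀ x, f (FreeGroup.of x) ∈ S (wt x)) {k : ℕ} {g : FreeGroup X}
    (hg : g ∈ weightSeries wt k) : f g ∈ S k :=
  mem_weightSeries.1 hg (fun k => (S k).comap f) (hS.comap f) hf

theorem weightSeries_eq_top_of_le {k : ℕ} (h : ∀ x, k ≤ wt x) : weightSeries wt k = ⊤ := by
  rw [eq_top_iff, ← FreeGroup.closure_range_of, Subgroup.closure_le]
  rintro _ ⟨x, rfl⟩
  exact weightSeries_isNSeries.antitone (h x) (of_mem_weightSeries x)

/-- An endomorphism moving generators by `m` steps moves everything by `m` steps. -/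
theorem inv_mul_mem_weightSeries {m : ℕ} {f : FreeGroup X →* FreeGroup X}
    (hf : ∀ x, (FreeGroup.of x)⁻¹ * f (FreeGroup.of x) ∈ weightSeries wt (wt x + m)) {k : ℕ}
    {g : FreeGroup X} (hg : g ∈ weightSeries wt k) : g⁻¹ * f g ∈ weightSeries wt (k + m) := by
  have hW := weightSeries_isNSeries (wt := wt)
  -- The elements with the desired property form an N-series containing the generators at their
  -- weights, so minimality gives everything.
  let T : ℕ → Subgroup (FreeGroup X) := fun k =>
    { carrier := {g | g ∈ weightSeries wt k ∧ (g : FreeGroup X ⧸ weightSeries wt (k + m)) = f g}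
      one_mem' := ⟨one_mem _, by simp⟩
      mul_mem' := fun {a b} ha hb => ⟨mul_mem ha.1 hb.1, by
        rw [map_mul, QuotientGroup.mk_mul, ha.2, hb.2, ← QuotientGroup.mk_mul]⟩
      inv_mem' := fun {a} ha => ⟨inv_mem ha.1, by
        rw [map_inv, QuotientGroup.mk_inv, ha.2, ← QuotientGroup.mk_inv]⟩ }
  have hT : IsNSeries T := by
    refine ⟨?_, ?_, ?_⟩
    · rw [eq_top_iff, ← FreeGroup.closure_range_of, Subgroup.closure_le]
      rintro _ ⟨x, rfl⟩
      refine ⟨by rw [hW.zero]; trivial, QuotientGroup.eq.2 (hW.antitone (by omega) (hf x))⟩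
    · rintro i j hij g ⟨hg, hg'⟩
      exact ⟨hW.antitone hij hg,
        QuotientGroup.eq.2 (hW.antitone (by omega) (QuotientGroup.eq.1 hg'))⟩
    · intro i j
      rw [Subgroup.commutator_le]
      rintro a ⟨ha, ha'⟩ b ⟨hb, hb'⟩
      refine ⟨hW.commutator_mem ha hb, ?_⟩
      obtain ⟨u, hu, eu⟩ : ∃ u ∈ weightSeries wt (i + m), f a = a * u :=
        ⟨a⁻¹ * f a, QuotientGroup.eq.1 ha', by group⟩
      obtain ⟨v, hv, ev⟩ : ∃ v ∈ weightSeries wt (j + m), f b = b * v :=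
        ⟨b⁻¹ * f b, QuotientGroup.eq.1 hb', by group⟩
      -- With f a = a u and f b = b v, the pairs (a, v), (u, b), (u, v) commute modulo the target
      -- term, so u and v cancel from the commutator.
      have comm : ∀ {p q : ℕ} {y z : FreeGroup X}, y ∈ weightSeries wt p →
          z ∈ weightSeries wt q → i + j + m ≤ p + q →
          Commute (y : FreeGroup X ⧸ weightSeries wt (i + j + m)) z := by
        intro p q y z hy hz hpq
        rw [← commutatorElement_eq_one_iff_commute]
        have h1 := hW.antitone hpq (hW.commutator_mem hy hz)
        rw [← QuotientGroup.eq_one_iff] at h1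
        exact h1
      rw [map_commutatorElement, eu, ev]
      have c1 := comm ha hv (by omega)
      have c2 := comm hu hb (by omega)
      have c3 := comm hu hv (by omega)
      simp only [commutatorElement_def, QuotientGroup.mk_mul, QuotientGroup.mk_inv]
      generalize (a : FreeGroup X ⧸ weightSeries wt (i + j + m)) = a at *
      generalize (b : FreeGroup X ⧸ weightSeries wt (i + j + m)) = b at *
      generalize (u : FreeGroup X ⧸ weightSeries wt (i + j + m)) = u at *
      generalize (v : FreeGroup X ⧸ weightSeries wt (i + j + m)) = v at *
      calc a * b * a⁻¹ * b⁻¹ = a * b * (u * v * u⁻¹ * v⁻¹) * a⁻¹ * b⁻¹ := by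
            rw [c3.eq]; group
        _ = a * (b * u) * v * u⁻¹ * (v⁻¹ * a⁻¹) * b⁻¹ := by group
        _ = a * (u * b) * v * u⁻¹ * (a⁻¹ * v⁻¹) * b⁻¹ := by
            rw [c2.eq, (c1.inv_inv).eq]
        _ = a * u * (b * v) * (a * u)⁻¹ * (b * v)⁻¹ := by group
  have h1 := map_mem_of_mem_weightSeries (f := MonoidHom.id _) hT
    (fun x => ⟨of_mem_weightSeries x, QuotientGroup.eq.2 (hf x)⟩) hg
  exact QuotientGroup.eq.1 h1.2

end weightSeries

/-! ### Elimination of a generator, and torsion-freeness -/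

section Elimination

variable {X : Type} (wt : X → ℕ) (x₀ : X) (K : ℕ)

/-- The iterated commutators `[y, x₀, …, x₀]` serving as generators after eliminating `x₀`. -/
def iteratedCommutator (y : X) : ℕ → FreeGroup X
  | 0 => FreeGroup.of y
  | k + 1 => ⁅(iteratedCommutator y k)⁻¹, FreeGroup.of x₀⁆

theorem iteratedCommutator_mem (y : X) (k : ℕ) :
    iteratedCommutator x₀ y k ∈ weightSeries wt (wt y + k * wt x₀) := by
  induction k with
  | zero => simpa [iteratedCommutator] using of_mem_weightSeries (wt := wt) y
  | succ k ih =>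
    rw [add_mul, one_mul, ← add_assoc]
    exact weightSeries_isNSeries.commutator_mem (inv_mem ih) (of_mem_weightSeries x₀)

/-- The weights of the generators obtained by eliminating `x₀`. -/
def elimWeight (p : {y : X // y ≠ x₀} × ℕ) : ℕ := wt p.1 + p.2 * wt x₀

/-- The effect of conjugation by `x₀` on the generators obtained by eliminating it. -/
def elimShift : FreeGroup ({y : X // y ≠ x₀} × ℕ) →* FreeGroup ({y : X // y ≠ x₀} × ℕ) :=
  FreeGroup.lift fun p => FreeGroup.of p * FreeGroup.of (p.1, p.2 + 1)

/-- The realisation of the new generators as iterated commutators. -/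
def elimRealize : FreeGroup ({y : X // y ≠ x₀} × ℕ) →* FreeGroup X :=
  FreeGroup.lift fun p => iteratedCommutator x₀ p.1 p.2

theorem elimRealize_mem {k : ℕ} {g : FreeGroup ({y : X // y ≠ x₀} × ℕ)}
    (hg : g ∈ weightSeries (elimWeight wt x₀) k) : elimRealize x₀ g ∈ weightSeries wt k := by
  refine map_mem_of_mem_weightSeries weightSeries_isNSeries (fun p => ?_) hg
  rw [elimRealize, FreeGroup.lift_apply_of]
  exact iteratedCommutator_mem wt x₀ p.1 p.2

/-- The inverse in the iterated commutators is chosen so that c ⁅c⁻¹, x₀⁆ = x₀ c x₀⁻¹; the shift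
thus models conjugation by x₀. -/
theorem elimRealize_elimShift (g : FreeGroup ({y : X // y ≠ x₀} × ℕ)) :
    elimRealize x₀ (elimShift x₀ g) =
      FreeGroup.of x₀ * elimRealize x₀ g * (FreeGroup.of x₀)⁻¹ := by
  have h : (elimRealize x₀).comp (elimShift x₀) =
      (MulAut.conj (FreeGroup.of x₀)).toMonoidHom.comp (elimRealize x₀) := by
    ext p
    simp only [elimRealize, elimShift, MonoidHom.comp_apply, FreeGroup.lift_apply_of, map_mul,
      MulEquiv.coe_toMonoidHom, MulAut.conj_apply, iteratedCommutator, commutatorElement_def]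
    group
  exact DFunLike.congr_fun h g

theorem inv_mul_elimShift_mem {k : ℕ} {g : FreeGroup ({y : X // y ≠ x₀} × ℕ)}
    (hg : g ∈ weightSeries (elimWeight wt x₀) k) :
    g⁻¹ * elimShift x₀ g ∈ weightSeries (elimWeight wt x₀) (k + wt x₀) := by
  refine inv_mul_mem_weightSeries (fun p => ?_) hg
  rw [elimShift, FreeGroup.lift_apply_of, inv_mul_cancel_left]
  have h := of_mem_weightSeries (wt := elimWeight wt x₀) (p.1, p.2 + 1)
  rwa [show elimWeight wt x₀ (p.1, p.2 + 1) = elimWeight wt x₀ p + wt x₀ by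
    simp only [elimWeight]; ring] at h

/-- Truncation of the free group on the generators obtained by eliminating `x₀`. -/
abbrev ElimGroup : Type :=
  FreeGroup ({y : X // y ≠ x₀} × ℕ) ⧸ weightSeries (elimWeight wt x₀) K

/-- The series induced on the truncation. -/
def elimSeries (k : ℕ) : Subgroup (ElimGroup wt x₀ K) :=
  (weightSeries (elimWeight wt x₀) k).map (QuotientGroup.mk' _)

theorem elimSeries_isNSeries : IsNSeries (elimSeries wt x₀ K) :=
  weightSeries_isNSeries.map (QuotientGroup.mk'_surjective _)

theorem elimSeries_eq_bot : elimSeries wt x₀ K K = ⊥ := by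
  rw [elimSeries, Subgroup.map_eq_bot_iff, QuotientGroup.ker_mk']

/-- The shift on the truncation. -/
def elimShiftQuotient : ElimGroup wt x₀ K →* ElimGroup wt x₀ K :=
  QuotientGroup.map _ _ (elimShift x₀) fun g hg => by
    have h := mul_mem hg (weightSeries_isNSeries.antitone (Nat.le_add_right K (wt x₀))
      (inv_mul_elimShift_mem wt x₀ hg))
    rwa [mul_inv_cancel_left] at h

theorem elimShiftQuotient_isNearId :
    IsNearId (elimSeries wt x₀ K) (wt x₀) (elimShiftQuotient wt x₀ K) := by
  rintro k _ ⟨g, hg, rfl⟩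
  exact ⟨g⁻¹ * elimShift x₀ g, inv_mul_elimShift_mem wt x₀ hg, rfl⟩

/-- The realisation of the new generators on the truncations. -/
def elimRealizeQuotient : ElimGroup wt x₀ K →* FreeGroup X ⧸ weightSeries wt K :=
  QuotientGroup.map _ _ (elimRealize x₀) fun _ hg => elimRealize_mem wt x₀ hg

theorem elimRealizeQuotient_elimShiftQuotient (g : ElimGroup wt x₀ K) :
    elimRealizeQuotient wt x₀ K (elimShiftQuotient wt x₀ K g) =
      (FreeGroup.of x₀ : FreeGroup X ⧸ weightSeries wt K) * elimRealizeQuotient wt x₀ K g *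
        (FreeGroup.of x₀ : FreeGroup X ⧸ weightSeries wt K)⁻¹ := by
  obtain ⟨g, rfl⟩ := QuotientGroup.mk_surjective g
  exact congrArg (QuotientGroup.mk (s := weightSeries wt K)) (elimRealize_elimShift x₀ g)

variable (hx₀ : 1 ≤ wt x₀)

/-- The shift as an automorphism of the truncation. -/
noncomputable def elimAut (hx₀ : 1 ≤ wt x₀) : MulAut (ElimGroup wt x₀ K) :=
  MulEquiv.ofBijective (elimShiftQuotient wt x₀ K)
    ⟨(elimShiftQuotient_isNearId wt x₀ K).injective (elimSeries_isNSeries wt x₀ K)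
      (elimSeries_eq_bot wt x₀ K) hx₀, fun h => by
      obtain ⟨g, -, hg⟩ := (elimShiftQuotient_isNearId wt x₀ K).exists_eq
        (elimSeries_isNSeries wt x₀ K) (elimSeries_eq_bot wt x₀ K) hx₀ (k := 0) (h := h)
        (by rw [(elimSeries_isNSeries wt x₀ K).zero]; trivial)
      exact ⟨g, hg⟩⟩

/-- Negative powers are covered because near-identity automorphisms form a group. -/
theorem elimAut_zpow_isNearId (q : Multiplicative ℤ) :
    IsNearId (elimSeries wt x₀ K) (wt x₀)
      (zpowersHom _ (elimAut wt x₀ K hx₀) q).toMonoidHom := by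
  have h : elimAut wt x₀ K hx₀ ∈ nearIdSubgroup (elimSeries_isNSeries wt x₀ K)
      (elimSeries_eq_bot wt x₀ K) hx₀ := elimShiftQuotient_isNearId wt x₀ K
  exact zpow_mem h q.toAdd

theorem elimRealizeQuotient_elimAut_zpow (z : ℤ) (g : ElimGroup wt x₀ K) :
    elimRealizeQuotient wt x₀ K ((elimAut wt x₀ K hx₀ ^ z) g) =
      (FreeGroup.of x₀ : FreeGroup X ⧸ weightSeries wt K) ^ z * elimRealizeQuotient wt x₀ K g *
        ((FreeGroup.of x₀ : FreeGroup X ⧸ weightSeries wt K) ^ z)⁻¹ := by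
  have h1 : ∀ g, elimRealizeQuotient wt x₀ K (elimAut wt x₀ K hx₀ g) = _ :=
    elimRealizeQuotient_elimShiftQuotient wt x₀ K
  induction z using Int.induction_on generalizing g with
  | zero => simp
  | succ n ih =>
    rw [zpow_add_one, MulAut.mul_apply, ih, h1, zpow_add_one]
    group
  | pred n ih =>
    rw [zpow_sub_one, MulAut.mul_apply, ih, zpow_sub_one]
    have h2 := h1 ((elimAut wt x₀ K hx₀)⁻¹ g)
    rw [MulAut.apply_inv_self] at h2
    rw [h2]
    group

/-- The semidirect product in which `x₀` acts on the eliminated generators. -/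
abbrev ElimSemidirect (hx₀ : 1 ≤ wt x₀) : Type :=
  ElimGroup wt x₀ K ⋊[zpowersHom _ (elimAut wt x₀ K hx₀)] Multiplicative ℤ

/-- The map from the semidirect product back to the truncated free group. -/
noncomputable def elimReturn : ElimSemidirect wt x₀ K hx₀ →* FreeGroup X ⧸ weightSeries wt K :=
  SemidirectProduct.lift (elimRealizeQuotient wt x₀ K)
    (zpowersHom _ (FreeGroup.of x₀ : FreeGroup X ⧸ weightSeries wt K)) fun q => by
      refine MonoidHom.ext fun g => ?_
      exact elimRealizeQuotient_elimAut_zpow wt x₀ K hx₀ q.toAdd g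

open Classical in
/-- The decomposition of the free group as a semidirect product, up to truncation. -/
noncomputable def elimSplit : FreeGroup X →* ElimSemidirect wt x₀ K hx₀ :=
  FreeGroup.lift fun x => if h : x = x₀ then SemidirectProduct.inr (Multiplicative.ofAdd 1)
    else SemidirectProduct.inl
      ((FreeGroup.of (⟨x, h⟩, 0) : FreeGroup ({y : X // y ≠ x₀} × ℕ)) : ElimGroup wt x₀ K)

theorem elimReturn_elimSplit (g : FreeGroup X) :
    elimReturn wt x₀ K hx₀ (elimSplit wt x₀ K hx₀ g) = (g : FreeGroup X ⧸ weightSeries wt K) := by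
  have h : (elimReturn wt x₀ K hx₀).comp (elimSplit wt x₀ K hx₀) = QuotientGroup.mk' _ := by
    refine FreeGroup.ext_hom _ _ fun x => ?_
    rw [MonoidHom.comp_apply, elimSplit, FreeGroup.lift_apply_of]
    split_ifs with hx
    · rw [elimReturn, SemidirectProduct.lift_inr, hx]
      simp
    · rw [elimReturn, SemidirectProduct.lift_inl]
      change ((elimRealize x₀ (FreeGroup.of _) : FreeGroup X) : FreeGroup X ⧸ weightSeries wt K) = _
      rw [elimRealize, FreeGroup.lift_apply_of]
      rfl
  exact DFunLike.congr_fun h g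

/-- The semidirect series contains the image of each generator at its weight, and its K-th term is
trivial because K exceeds the weight of x₀. With `elimReturn_elimSplit`, the kernel of the splitting
is exactly the K-th term. -/
theorem elimSplit_eq_one (hK : wt x₀ < K) {g : FreeGroup X} (hg : g ∈ weightSeries wt K) :
    elimSplit wt x₀ K hx₀ g = 1 := by
  have h := map_mem_of_mem_weightSeries (semidirectSeries_isNSeries
    (elimSeries_isNSeries wt x₀ K) (wt x₀) (zpowersHom _ (elimAut wt x₀ K hx₀))
    (elimAut_zpow_isNearId wt x₀ K hx₀)) (f := elimSplit wt x₀ K hx₀) (fun x => ?_) hg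
  · obtain ⟨h1, h2⟩ := h
    rw [elimSeries_eq_bot, Subgroup.mem_bot] at h1
    exact SemidirectProduct.ext h1 (h2.resolve_left (by omega))
  · rw [elimSplit, FreeGroup.lift_apply_of]
    split_ifs with hx
    · rw [hx]
      exact ⟨one_mem _, Or.inl le_rfl⟩
    · refine ⟨⟨_, ?_, rfl⟩, Or.inr rfl⟩
      have h := of_mem_weightSeries (wt := elimWeight wt x₀) (⟨x, hx⟩, 0)
      simpa [elimWeight] using h

/-- Isolation of a subgroup: it contains every element having a nontrivial power in it. -/
def IsIsolated {G : Type} [Group G] (H : Subgroup G) : Prop :=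
  ∀ g : G, ∀ n : ℕ, n ≠ 0 → g ^ n ∈ H → g ∈ H

/-- A torsion element of the semidirect product has trivial component in ℤ, hence lies in the
eliminated truncation, where the hypothesis applies. -/
theorem isIsolated_of_elim (hx₀ : 1 ≤ wt x₀) (hK : wt x₀ < K)
    (h : IsIsolated (weightSeries (elimWeight wt x₀) K)) : IsIsolated (weightSeries wt K) := by
  intro g n hn hg
  have h1 := elimSplit_eq_one wt x₀ K hx₀ hK hg
  rw [map_pow] at h1
  have h2 : (elimSplit wt x₀ K hx₀ g).right = 1 := by
    have h3 := congrArg SemidirectProduct.rightHom h1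
    rw [map_pow, map_one] at h3
    exact (pow_eq_one_iff_left hn).1 h3
  have h3 : elimSplit wt x₀ K hx₀ g = SemidirectProduct.inl (elimSplit wt x₀ K hx₀ g).left :=
    SemidirectProduct.ext rfl h2
  have h4 : (elimSplit wt x₀ K hx₀ g).left = 1 := by
    rw [h3, ← map_pow, ← map_one SemidirectProduct.inl, SemidirectProduct.inl_inj] at h1
    obtain ⟨u, hu⟩ := QuotientGroup.mk_surjective (elimSplit wt x₀ K hx₀ g).left
    rw [← hu] at h1 ⊢
    rw [← QuotientGroup.mk_pow, QuotientGroup.eq_one_iff] at h1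
    exact (QuotientGroup.eq_one_iff _).2 (h u n hn h1)
  have h5 := elimReturn_elimSplit wt x₀ K hx₀ g
  rw [h3, h4, map_one, map_one] at h5
  exact (QuotientGroup.eq_one_iff _).1 h5.symm

end Elimination

/-- Double induction: on the gap j between the least weight and K, then on the number of generators
of weight i. Elimination creates infinitely many generators, so finiteness is asked only below each
weight bound. -/
theorem weightSeries_isIsolated_aux (K j : ℕ) : ∀ i, 1 ≤ i → K ≤ i + j →
    ∀ (X : Type) (wt : X → ℕ), (∀ x, i ≤ wt x) → (∀ k, {x | wt x ≤ k}.Finite) →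
      IsIsolated (weightSeries wt K) := by
  induction j with
  | zero =>
    intro i _ hK X wt hwt _ g n _ _
    rw [weightSeries_eq_top_of_le fun x => hK.trans (hwt x)]
    trivial
  | succ j ihj =>
    intro i hi hK X wt hwt hfin
    by_cases hiK : K ≤ i
    · intro g n _ _
      rw [weightSeries_eq_top_of_le fun x => hiK.trans (hwt x)]
      trivial
    have hfin' : ∀ {X : Type} {wt : X → ℕ}, (∀ k, {x | wt x ≤ k}.Finite) →
        {x | wt x = i}.Finite := fun h => (h i).subset fun x hx => le_of_eq hx
    induction hc : {x | wt x = i}.ncard generalizing X wt with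
    | zero =>
      rw [Set.ncard_eq_zero (hfin' hfin)] at hc
      refine ihj (i + 1) (by omega) (by omega) X wt (fun x => ?_) hfin
      refine lt_of_le_of_ne (hwt x) fun h => ?_
      have : x ∈ {x | wt x = i} := h.symm
      rw [hc] at this
      exact this
    | succ c ihc =>
      obtain ⟨x₀, hx₀⟩ : {x | wt x = i}.Nonempty := by
        rw [← Set.ncard_pos (hfin' hfin)]
        omega
      change wt x₀ = i at hx₀
      have hfinY : ∀ k, {p | elimWeight wt x₀ p ≤ k}.Finite := by
        intro k
        refine Set.Finite.subset (((hfin k).preimage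
          (Subtype.val_injective.injOn (s := _))).prod (Set.finite_Iic k)) ?_
        rintro ⟨y, l⟩ hp
        change wt y + l * wt x₀ ≤ k at hp
        refine ⟨show wt y ≤ k by omega, show l ≤ k from ?_⟩
        have : l * 1 ≤ l * wt x₀ := Nat.mul_le_mul_left l (by omega)
        omega
      refine isIsolated_of_elim wt x₀ K (by omega) (by omega)
        (ihc _ _ (fun p => (hwt p.1).trans (Nat.le_add_right _ _)) hfinY ?_)
      -- The new generators of weight i are the pairs (y, 0) with y ≠ x₀ of weight i, since each
      -- bracketing with x₀ raises the weight.
      have himage : {x | wt x = i} \ {x₀} =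
          (fun p : {y : X // y ≠ x₀} × ℕ => (p.1 : X)) '' {p | elimWeight wt x₀ p = i} := by
        ext x
        constructor
        · rintro ⟨hx, hxx⟩
          exact ⟨(⟨x, hxx⟩, 0), by simpa [elimWeight] using hx, rfl⟩
        · rintro ⟨⟨y, l⟩, hp, rfl⟩
          change wt y + l * wt x₀ = i at hp
          have := hwt y
          exact ⟨show wt y = i by omega, y.2⟩
      have hinj : Set.InjOn (fun p : {y : X // y ≠ x₀} × ℕ => (p.1 : X))
          {p | elimWeight wt x₀ p = i} := by
        have hl : ∀ p : {y : X // y ≠ x₀} × ℕ, elimWeight wt x₀ p = i → p.2 = 0 := by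
          intro p hp
          have h1 := hwt p.1
          simp only [elimWeight] at hp
          have h2 : p.2 * wt x₀ = 0 := by omega
          rcases Nat.mul_eq_zero.1 h2 with h | h
          · exact h
          · omega
        intro p hp q hq hpq
        exact Prod.ext (Subtype.ext hpq) ((hl p hp).trans (hl q hq).symm)
      rw [← hinj.ncard_image, ← himage,
        Set.ncard_sdiff_singleton_of_mem (show x₀ ∈ {x | wt x = i} from hx₀), hc]
      rfl

/-- Weighted free nilpotent groups on finitely many generators are torsion-free. -/
theorem weightSeries_isIsolated {X : Type} [Finite X] {wt : X → ℕ} (hwt : ∀ x, 1 ≤ wt x) (K : ℕ) :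
    IsIsolated (weightSeries wt K) :=
  weightSeries_isIsolated_aux K K 1 le_rfl (by omega) X wt hwt fun _ => Set.toFinite _

/-! ### The lower central series -/

section LowerCentralSeries

variable {G : Type} [Group G]

/-- Three subgroups lemma, applied in the quotient by the target term so that the inclusions become
equalities with the trivial subgroup. -/
theorem commutator_lowerCentralSeries_le (i j : ℕ) :
    ⁅(⊤ : Subgroup G).lowerCentralSeries i, (⊤ : Subgroup G).lowerCentralSeries j⁆ ≤
      (⊤ : Subgroup G).lowerCentralSeries (i + j + 1) := by
  induction j generalizing i with
  | zero => exact le_rfl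
  | succ j ih =>
    have key : ∀ (Q : Type) [Group Q], (⊤ : Subgroup Q).lowerCentralSeries (i + (j + 1) + 1) = ⊥ →
        (∀ i, ⁅(⊤ : Subgroup Q).lowerCentralSeries i, (⊤ : Subgroup Q).lowerCentralSeries j⁆ ≤
          (⊤ : Subgroup Q).lowerCentralSeries (i + j + 1)) →
        ⁅(⊤ : Subgroup Q).lowerCentralSeries i,
          (⊤ : Subgroup Q).lowerCentralSeries (j + 1)⁆ = ⊥ := by
      intro Q _ hQ ihQ
      rw [Subgroup.commutator_comm, Subgroup.lowerCentralSeries_succ]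
      refine Subgroup.commutator_commutator_eq_bot_of_rotate ?_ ?_
      · rw [Subgroup.commutator_comm ⊤, ← Subgroup.lowerCentralSeries_succ, ← le_bot_iff, ← hQ,
          show i + (j + 1) + 1 = i + 1 + j + 1 by omega]
        exact ihQ (i + 1)
      · rw [← le_bot_iff, ← hQ]
        exact Subgroup.commutator_mono (ihQ i) le_rfl
    have hmap : ∀ k, ((⊤ : Subgroup G).lowerCentralSeries k).map
        (QuotientGroup.mk' ((⊤ : Subgroup G).lowerCentralSeries (i + (j + 1) + 1))) =
        (⊤ : Subgroup (G ⧸ (⊤ : Subgroup G).lowerCentralSeries (i + (j + 1) + 1))).lowerCentralSeries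
          k := by
      intro k
      rw [Subgroup.map_lowerCentralSeries,
        Subgroup.map_top_of_surjective _ (QuotientGroup.mk'_surjective _)]
    have h := key (G ⧸ (⊤ : Subgroup G).lowerCentralSeries (i + (j + 1) + 1))
      (by rw [← hmap, Subgroup.map_eq_bot_iff, QuotientGroup.ker_mk'])
      (fun i' => by
        rw [← hmap, ← hmap, ← hmap, ← Subgroup.map_commutator]
        exact Subgroup.map_mono (ih i'))
    rwa [← hmap, ← hmap, ← Subgroup.map_commutator, Subgroup.map_eq_bot_iff,
      QuotientGroup.ker_mk'] at h

/-- Truncated subtraction places the whole group at both indices 0 and 1. -/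
theorem lowerCentralSeries_isNSeries :
    IsNSeries fun k => (⊤ : Subgroup G).lowerCentralSeries (k - 1) where
  zero := rfl
  antitone i j hij :=
    Subgroup.lowerCentralSeries_antitone _ (by omega : i - 1 ≤ j - 1)
  commutator_le i j := (commutator_lowerCentralSeries_le (i - 1) (j - 1)).trans
    (Subgroup.lowerCentralSeries_antitone _ (by omega : i + j - 1 ≤ i - 1 + (j - 1) + 1))

theorem IsNSeries.lowerCentralSeries_le {S : ℕ → Subgroup G} (hS : IsNSeries S) (h1 : S 1 = ⊤)
    (k : ℕ) : (⊤ : Subgroup G).lowerCentralSeries k ≤ S (k + 1) := by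
  induction k with
  | zero => rw [h1]; exact le_top
  | succ k ih =>
    exact (Subgroup.commutator_mono ih h1.ge).trans (hS.commutator_le (k + 1) 1)

theorem weightSeries_one_eq_lowerCentralSeries (X : Type) (k : ℕ) :
    weightSeries (fun _ : X => 1) (k + 1) = (⊤ : Subgroup (FreeGroup X)).lowerCentralSeries k := by
  refine le_antisymm (fun g hg => ?_) ?_
  · exact mem_weightSeries.1 hg _ lowerCentralSeries_isNSeries fun x => Subgroup.mem_top _
  · exact weightSeries_isNSeries.lowerCentralSeries_le
      (weightSeries_eq_top_of_le fun _ => le_rfl) k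

/-- Finitely generated free nilpotent groups are torsion-free. -/
theorem lowerCentralSeries_isIsolated (X : Type) [Finite X] (k : ℕ) :
    IsIsolated ((⊤ : Subgroup (FreeGroup X)).lowerCentralSeries k) := by
  rw [← weightSeries_one_eq_lowerCentralSeries]
  exact weightSeries_isIsolated (fun _ => le_rfl) _

end LowerCentralSeries

/-! ### Commutators and powers -/

section Commutators

variable {H : Type} [Group H]

theorem commutatorElement_mul_left_of_commute {a a' b : H} (h : Commute a ⁅a', b⁆) :
    ⁅a * a', b⁆ = ⁅a', b⁆ * ⁅a, b⁆ := by
  rw [commutatorElement_mul_left_eq_conj_mul, h.eq, mul_inv_cancel_right]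

theorem commutatorElement_mul_right_of_commute {a b b' : H} (h : Commute b ⁅a, b'⁆) :
    ⁅a, b * b'⁆ = ⁅a, b⁆ * ⁅a, b'⁆ := by
  rw [commutatorElement_mul_right_eq_mul_conj, mul_assoc _ b, h.eq, ← mul_assoc,
    mul_inv_cancel_right]

theorem commutatorElement_pow_left_of_commute {a b : H} (h : Commute a ⁅a, b⁆) (n : ℕ) :
    ⁅a ^ n, b⁆ = ⁅a, b⁆ ^ n := by
  induction n with
  | zero => simp
  | succ n ih =>
    rw [pow_succ, commutatorElement_mul_left_of_commute (h.pow_left n), ih, pow_succ']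

theorem commutatorElement_pow_right_of_commute {a b : H} (h : Commute b ⁅a, b⁆) (n : ℕ) :
    ⁅a, b ^ n⁆ = ⁅a, b⁆ ^ n := by
  rw [← commutatorElement_inv, commutatorElement_pow_left_of_commute, ← inv_pow,
    commutatorElement_inv]
  rw [← commutatorElement_inv]
  exact h.inv_right

theorem commute_of_mem_lowerCentralSeries {n i j : ℕ}
    (hH : (⊤ : Subgroup H).lowerCentralSeries n = ⊥) (hn : n ≤ i + j + 1) {a b : H}
    (ha : a ∈ (⊤ : Subgroup H).lowerCentralSeries i)
    (hb : b ∈ (⊤ : Subgroup H).lowerCentralSeries j) : Commute a b := by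
  rw [← commutatorElement_eq_one_iff_commute, ← Subgroup.mem_bot, ← hH]
  exact Subgroup.lowerCentralSeries_antitone _ hn
    (commutator_lowerCentralSeries_le _ _ (Subgroup.commutator_mem_commutator ha hb))

theorem commute_of_mem_last {n : ℕ} (hH : (⊤ : Subgroup H).lowerCentralSeries (n + 1) = ⊥)
    {a : H} (ha : a ∈ (⊤ : Subgroup H).lowerCentralSeries n) (b : H) : Commute a b :=
  commute_of_mem_lowerCentralSeries (j := 0) hH (by omega) ha trivial

theorem map_mem_lowerCentralSeries {F : Type} [Group F] (f : F →* H) {n : ℕ} {g : F}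
    (hg : g ∈ (⊤ : Subgroup F).lowerCentralSeries n) :
    f g ∈ (⊤ : Subgroup H).lowerCentralSeries n := by
  have h := Subgroup.mem_map_of_mem f hg
  rw [Subgroup.map_lowerCentralSeries] at h
  exact Subgroup.lowerCentralSeries_mono n le_top h

theorem map_eq_one_of_mem_lowerCentralSeries {F : Type} [Group F] (f : F →* H) {n : ℕ}
    (hH : (⊤ : Subgroup H).lowerCentralSeries n = ⊥) {g : F}
    (hg : g ∈ (⊤ : Subgroup F).lowerCentralSeries n) : f g = 1 := by
  rw [← Subgroup.mem_bot, ← hH]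
  exact map_mem_lowerCentralSeries f hg

theorem lowerCentralSeries_quotient_eq_bot (n : ℕ) :
    (⊤ : Subgroup (H ⧸ (⊤ : Subgroup H).lowerCentralSeries n)).lowerCentralSeries n = ⊥ := by
  rw [← Subgroup.map_top_of_surjective _ (QuotientGroup.mk'_surjective _),
    ← Subgroup.map_lowerCentralSeries, Subgroup.map_eq_bot_iff, QuotientGroup.ker_mk']

theorem lowerCentralSeries_eq_bot_of_le {m n : ℕ} (hmn : m ≤ n)
    (h : (⊤ : Subgroup H).lowerCentralSeries m = ⊥) :
    (⊤ : Subgroup H).lowerCentralSeries n = ⊥ :=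
  le_bot_iff.1 (h ▸ Subgroup.lowerCentralSeries_antitone _ hmn)

/-- Two homomorphisms which differ by an `e`-th power on the abelianization differ by an
`e ^ n`-th power on the last nontrivial term of the lower central series. -/
theorem map_eq_pow_of_mem_lowerCentralSeries {F : Type} [Group F] {e m : ℕ}
    (hH : (⊤ : Subgroup H).lowerCentralSeries (m + 1) = ⊥) {φ ψ : F →* H}
    (h : ∀ g, (φ g ^ e)⁻¹ * ψ g ∈ (⊤ : Subgroup H).lowerCentralSeries 1) {g : F}
    (hg : g ∈ (⊤ : Subgroup F).lowerCentralSeries m) : ψ g = φ g ^ e ^ (m + 1) := by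
  induction m generalizing H g with
  | zero =>
    have h1 := h g
    rw [hH, Subgroup.mem_bot] at h1
    rw [zero_add, pow_one]
    exact (inv_mul_eq_one.1 h1).symm
  | succ m ih =>
    have hlast : ∀ g ∈ (⊤ : Subgroup F).lowerCentralSeries (m + 1), ∀ b, Commute (φ g) b :=
      fun g hg b => commute_of_mem_last hH (map_mem_lowerCentralSeries φ hg) b
    have hg' := hg
    rw [Subgroup.lowerCentralSeries_succ, Subgroup.commutator_def] at hg
    induction hg using Subgroup.closure_induction with
    | mem g hg =>
      obtain ⟨p, hp, q, -, rfl⟩ := hg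
      let π := QuotientGroup.mk' ((⊤ : Subgroup H).lowerCentralSeries (m + 1))
      -- Modulo the last term the induction applies to p; the discrepancy c is central, that of q
      -- lies in the commutator subgroup, and bilinearity of ⁅p, q⁆ multiplies the exponents e ^ (m
      -- + 1) and e.
      have h1 : π (ψ p) = π (φ p) ^ e ^ (m + 1) :=
        ih (H := H ⧸ (⊤ : Subgroup H).lowerCentralSeries (m + 1))
          (lowerCentralSeries_quotient_eq_bot _) (φ := π.comp φ) (ψ := π.comp ψ)
          (fun g => by
            have h2 := map_mem_lowerCentralSeries π (h g)
            simpa only [map_mul, map_inv, map_pow, MonoidHom.comp_apply] using h2) hp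
      obtain ⟨c, hc, hpc⟩ : ∃ c ∈ (⊤ : Subgroup H).lowerCentralSeries (m + 1),
          ψ p = φ p ^ e ^ (m + 1) * c := by
        refine ⟨(φ p ^ e ^ (m + 1))⁻¹ * ψ p, ?_, by group⟩
        rw [← map_pow] at h1
        exact QuotientGroup.eq.1 h1.symm
      obtain ⟨c', hc', hqc⟩ : ∃ c' ∈ (⊤ : Subgroup H).lowerCentralSeries 1,
          ψ q = φ q ^ e * c' := ⟨_, h q, by group⟩
      have hP := map_mem_lowerCentralSeries φ hp
      have h3 : ∀ b, Commute c b := fun b => commute_of_mem_last hH hc b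
      have h4 : ∀ b, Commute ⁅φ p, φ q⁆ b := by
        rw [← map_commutatorElement]
        exact hlast _ hg'
      have h5 : Commute (φ p ^ e ^ (m + 1)) c' :=
        (commute_of_mem_lowerCentralSeries hH (by omega) hP hc').pow_left _
      have h6 : ⁅φ p ^ e ^ (m + 1), φ q⁆ = ⁅φ p, φ q⁆ ^ e ^ (m + 1) :=
        commutatorElement_pow_left_of_commute (h4 _).symm _
      rw [map_commutatorElement, map_commutatorElement, hpc, hqc,
        commutatorElement_mul_left_of_commute, (h3 _).commutator_eq, one_mul,
        commutatorElement_mul_right_of_commute, h5.commutator_eq, mul_one,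
        commutatorElement_pow_right_of_commute, h6, ← pow_mul, ← pow_succ]
      · rw [h6]
        exact ((h4 _).pow_left _).symm
      · rw [h5.commutator_eq]
        exact Commute.one_right _
      · rw [(h3 _).commutator_eq]
        exact Commute.one_right _
    | one => simp
    | mul a b ha hb iha ihb =>
      rw [map_mul, map_mul, iha ha, ihb hb, (hlast a ha _).mul_pow]
    | inv a ha iha =>
      rw [map_inv, map_inv, iha ha, inv_pow]

end Commutators

/-! ### Cocycles -/

section Cocycles

variable {H M : Type} [Group H] [AddCommGroup M] {f : H → H → M}

/-- Alternating sum of the cocycle identities at (a,b,c), (c,a,b) and (a,c,b). -/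
theorem cocycle_antisymm_mul_left
    (hf : ∀ a b c, f a b + f (a * b) c = f b c + f a (b * c))
    (hr : ∀ a b c, f a (b * c) = f a (c * b)) (hl : ∀ a b c, f (a * b) c = f (b * a) c)
    (a b c : H) :
    f (a * b) c - f c (a * b) = (f a c - f c a) + (f b c - f c b) := by
  have h1 := hf a b c
  have h2 := hf c a b
  have h3 := hf a c b
  rw [hl a c b, hr a c b] at h3
  have e : f (a * b) c - f c (a * b) - ((f a c - f c a) + (f b c - f c b)) =
      (f a b + f (a * b) c - (f b c + f a (b * c))) + (f c a + f (c * a) b - (f a b + f c (a * b)))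
      - (f a c + f (c * a) b - (f c b + f a (b * c))) := by abel
  rw [h1, h2, h3] at e
  simpa [sub_eq_zero] using e

/-- The antisymmetrisation of a cocycle is quadratic. -/
theorem cocycle_antisymm_sq
    (hf : ∀ a b c, f a b + f (a * b) c = f b c + f a (b * c))
    (hr : ∀ a b c, f a (b * c) = f a (c * b)) (hl : ∀ a b c, f (a * b) c = f (b * a) c)
    (a b : H) :
    f (a * a) (b * b) - f (b * b) (a * a) = 4 • (f a b - f b a) := by
  have h := cocycle_antisymm_mul_left hf hr hl
  have h1 := h a a (b * b)
  have h2 := h b b a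
  have e : f (a * a) (b * b) - f (b * b) (a * a) - 4 • (f a b - f b a) =
      (f (a * a) (b * b) - f (b * b) (a * a) -
        ((f a (b * b) - f (b * b) a) + (f a (b * b) - f (b * b) a)))
      - 2 • (f (b * b) a - f a (b * b) - ((f b a - f a b) + (f b a - f a b))) := by abel
  refine sub_eq_zero.1 (e.trans ?_)
  rw [h1, h2, sub_self, sub_self, smul_zero, sub_zero]

/-- A symmetric cocycle vanishing on the diagonal is linear on diagonals. -/
theorem cocycle_symm_sq
    (hf : ∀ a b c, f a b + f (a * b) c = f b c + f a (b * c))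
    (hr : ∀ a b c, f a (b * c) = f a (c * b))
    (hsymm : ∀ a b, f a b = f b a) (hdiag : ∀ a, f a a = 0) (a b : H) :
    f (a * a) (b * b) = 2 • f a b := by
  -- The first identity splits f a b into the two terms left over by the other two.
  have h1 := hf a b (a * b)
  have h2 := hf a a (b * b)
  have h3 := hf b b a
  rw [hdiag, hr a b (a * b), mul_assoc a b b, add_zero] at h1
  rw [hdiag, zero_add] at h2
  rw [hdiag, zero_add, hsymm (b * b) a, hsymm b a, hr b b a] at h3
  rw [h2, h3, two_nsmul, add_assoc, ← h1]

end Cocycles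

/-! ### Words in two letters -/

section Words

variable {H H' : Type} [Group H] [Group H']

/-- The value of a word in two letters. -/
def wordEval (w : FreeGroup (Fin 2)) (a b : H) : H := FreeGroup.lift ![a, b] w

/-- The first letter. -/
def letterX : FreeGroup (Fin 2) := FreeGroup.of 0

/-- The second letter. -/
def letterY : FreeGroup (Fin 2) := FreeGroup.of 1

@[simp] theorem wordEval_letterX (a b : H) : wordEval letterX a b = a := by
  simp [wordEval, letterX]

@[simp] theorem wordEval_letterY (a b : H) : wordEval letterY a b = b := by
  simp [wordEval, letterY]

theorem wordEval_mul (v w : FreeGroup (Fin 2)) (a b : H) :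
    wordEval (v * w) a b = wordEval v a b * wordEval w a b := map_mul _ _ _

theorem wordEval_inv (w : FreeGroup (Fin 2)) (a b : H) :
    wordEval w⁻¹ a b = (wordEval w a b)⁻¹ := map_inv _ _

theorem hom_ext_letters {f g : FreeGroup (Fin 2) →* H} (hx : f letterX = g letterX)
    (hy : f letterY = g letterY) : f = g := by
  refine FreeGroup.ext_hom _ _ fun i => ?_
  fin_cases i
  · exact hx
  · exact hy

theorem map_wordEval (f : H →* H') (w : FreeGroup (Fin 2)) (a b : H) :
    f (wordEval w a b) = wordEval w (f a) (f b) := by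
  have h : f.comp (FreeGroup.lift ![a, b]) = FreeGroup.lift ![f a, f b] :=
    hom_ext_letters (by simp [letterX]) (by simp [letterY])
  exact DFunLike.congr_fun h w

theorem wordEval_letters (w : FreeGroup (Fin 2)) : wordEval w letterX letterY = w := by
  have h : FreeGroup.lift ![letterX, letterY] = MonoidHom.id _ :=
    hom_ext_letters (by simp [letterX]) (by simp [letterY])
  exact DFunLike.congr_fun h w

theorem map_eq_wordEval (f : FreeGroup (Fin 2) →* H) (w : FreeGroup (Fin 2)) :
    f w = wordEval w (f letterX) (f letterY) := by
  rw [← map_wordEval, wordEval_letters]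

theorem commute_of_commute_letters {f : FreeGroup (Fin 2) →* H}
    (hf : Commute (f letterX) (f letterY)) (g h : FreeGroup (Fin 2)) : Commute (f g) (f h) := by
  have key : ∀ a : H, Commute a (f letterX) → Commute a (f letterY) → ∀ h, Commute a (f h) := by
    intro a hx hy h
    have : (Subgroup.centralizer {a}).comap f = ⊤ := by
      rw [eq_top_iff, ← FreeGroup.closure_range_of, Subgroup.closure_le]
      rintro _ ⟨i, rfl⟩
      simp only [SetLike.mem_coe, Subgroup.mem_comap, Subgroup.mem_centralizer_singleton_iff]
      fin_cases i
      · exact hx.symm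
      · exact hy.symm
    have h1 : h ∈ (Subgroup.centralizer {a}).comap f := this ▸ Subgroup.mem_top h
    exact (Subgroup.mem_centralizer_singleton_iff.1 h1).symm
  exact key _ (key _ (Commute.refl _) hf g).symm (key _ hf.symm (Commute.refl _) g).symm h

theorem map_eq_one_of_commute_letters {f : FreeGroup (Fin 2) →* H}
    (hf : Commute (f letterX) (f letterY)) {v : FreeGroup (Fin 2)}
    (hv : v ∈ (⊤ : Subgroup (FreeGroup (Fin 2))).lowerCentralSeries 1) : f v = 1 := by
  have h : ⁅(⊤ : Subgroup (FreeGroup (Fin 2))), ⊤⁆ ≤ f.ker :=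
    Subgroup.commutator_le.2 fun a _ b _ => by
      rw [MonoidHom.mem_ker, map_commutatorElement]
      exact (commute_of_commute_letters hf a b).commutator_eq
  exact h hv

theorem wordEval_eq_one_of_commute {a b : H} (hab : Commute a b) {v : FreeGroup (Fin 2)}
    (hv : v ∈ (⊤ : Subgroup (FreeGroup (Fin 2))).lowerCentralSeries 1) : wordEval v a b = 1 :=
  map_eq_one_of_commute_letters (f := FreeGroup.lift ![a, b])
    (by simpa [letterX, letterY] using hab) hv

/-- A word modulo the product of the letters. -/
def wordDefect (w : FreeGroup (Fin 2)) : FreeGroup (Fin 2) := (letterX * letterY)⁻¹ * w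

theorem wordEval_eq_mul_wordDefect (w : FreeGroup (Fin 2)) (a b : H) :
    wordEval w a b = a * b * wordEval (wordDefect w) a b := by
  rw [wordDefect, wordEval_mul, wordEval_inv, wordEval_mul, wordEval_letterX, wordEval_letterY,
    mul_inv_cancel_left]

theorem wordEval_eq_mul_of_wordDefect_mem {w : FreeGroup (Fin 2)} {n : ℕ}
    (hw : wordDefect w ∈ (⊤ : Subgroup (FreeGroup (Fin 2))).lowerCentralSeries n)
    (hH : (⊤ : Subgroup H).lowerCentralSeries n = ⊥) (a b : H) : wordEval w a b = a * b := by
  rw [wordEval_eq_mul_wordDefect, wordEval, map_eq_one_of_mem_lowerCentralSeries _ hH hw, mul_one]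

end Words

/-! ### Unital and associative word operations. -/

/-- A word inducing a unital operation on all groups of class at most `d`. -/
def IsUnitalWord (d : ℕ) (w : FreeGroup (Fin 2)) : Prop :=
  ∀ (H : Type) [Group H], (⊤ : Subgroup H).lowerCentralSeries d = ⊥ → ∀ a : H,
    wordEval w a 1 = a ∧ wordEval w 1 a = a

/-- A word inducing an associative operation on all groups of class at most `d`. -/
def IsAssocWord (d : ℕ) (w : FreeGroup (Fin 2)) : Prop :=
  ∀ (H : Type) [Group H], (⊤ : Subgroup H).lowerCentralSeries d = ⊥ → ∀ a b c : H,
    wordEval w (wordEval w a b) c = wordEval w a (wordEval w b c)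

/-- In the abelianization w(a, b) = w(a, 1) w(1, b), which the unit laws turn into ab. -/
theorem IsUnitalWord.wordDefect_mem {d : ℕ} (hd : 1 ≤ d) {w : FreeGroup (Fin 2)}
    (hw : IsUnitalWord d w) :
    wordDefect w ∈ (⊤ : Subgroup (FreeGroup (Fin 2))).lowerCentralSeries 1 := by
  let N := (⊤ : Subgroup (FreeGroup (Fin 2))).lowerCentralSeries 1
  have hQ := lowerCentralSeries_quotient_eq_bot (H := FreeGroup (Fin 2)) 1
  have hcomm : ∀ a b : FreeGroup (Fin 2) ⧸ N, Commute a b := fun a b =>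
    commute_of_mem_last hQ (n := 0) trivial b
  have hunit := hw _ (lowerCentralSeries_eq_bot_of_le hd hQ)
  have hmul : ∀ a b : FreeGroup (Fin 2) ⧸ N, wordEval w a b = wordEval w a 1 * wordEval w 1 b := by
    intro a b
    let _ : CommGroup (FreeGroup (Fin 2) ⧸ N) := { mul_comm := fun a b => hcomm a b }
    have h : FreeGroup.lift ![a, b] = FreeGroup.lift ![a, 1] * FreeGroup.lift ![1, b] :=
      hom_ext_letters (by simp [letterX]) (by simp [letterY])
    exact DFunLike.congr_fun h w
  have h1 := hmul (letterX : FreeGroup (Fin 2) ⧸ N) (letterY : FreeGroup (Fin 2) ⧸ N)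
  rw [(hunit _).1, (hunit _).2] at h1
  have h2 := map_eq_wordEval (QuotientGroup.mk' N) w
  exact QuotientGroup.eq.1 (h1.symm.trans h2.symm)

theorem two_pow_sub_smul_eq_zero {M : Type} [AddCommGroup M]
    (hM : ∀ (n : ℕ) (x : M), n ≠ 0 → n • x = 0 → x = 0) {p q : ℕ} (hpq : p < q) {x : M}
    (h : q • x = p • x) : x = 0 := by
  refine hM (q - p) x (by omega) ?_
  rw [← Nat.sub_add_cancel hpq.le, add_smul] at h
  exact add_eq_right.1 h

/-- An associative word which is multiplication up to class two is multiplication. -/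
theorem IsAssocWord.wordDefect_mem {d : ℕ} {w : FreeGroup (Fin 2)} (hw : IsAssocWord d w)
    (h2 : wordDefect w ∈ (⊤ : Subgroup (FreeGroup (Fin 2))).lowerCentralSeries 2) {m : ℕ}
    (hm : 2 ≤ m) (hmd : m ≤ d) :
    wordDefect w ∈ (⊤ : Subgroup (FreeGroup (Fin 2))).lowerCentralSeries m := by
  induction m, hm using Nat.le_induction with
  | base => exact h2
  | succ m hm ih =>
    have hv := ih (by omega)
    set v := wordDefect w with hvdef
    let N := (⊤ : Subgroup (FreeGroup (Fin 2))).lowerCentralSeries (m + 1)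
    let H := FreeGroup (Fin 2) ⧸ N
    have hH : (⊤ : Subgroup H).lowerCentralSeries (m + 1) = ⊥ :=
      lowerCentralSeries_quotient_eq_bot _
    have hassoc := hw H (lowerCentralSeries_eq_bot_of_le hmd hH)
    have hv1 : v ∈ (⊤ : Subgroup (FreeGroup (Fin 2))).lowerCentralSeries 1 :=
      Subgroup.lowerCentralSeries_antitone _ (by omega : 1 ≤ m) hv
    have hmem : ∀ a b : H, wordEval v a b ∈ (⊤ : Subgroup H).lowerCentralSeries m :=
      fun a b => map_mem_lowerCentralSeries _ hv
    have hcomm : ∀ a b c : H, Commute (wordEval v a b) c := fun a b c =>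
      commute_of_mem_last hH (hmem a b) c
    -- Homogeneity of degree m + 1; the case e = 1 says that v depends only on its arguments modulo
    -- commutators.
    have hgen : ∀ {e : ℕ} {a b a' b' : H},
        (a ^ e)⁻¹ * a' ∈ (⊤ : Subgroup H).lowerCentralSeries 1 →
        (b ^ e)⁻¹ * b' ∈ (⊤ : Subgroup H).lowerCentralSeries 1 →
        wordEval v a' b' = wordEval v a b ^ e ^ (m + 1) := by
      intro e a b a' b' ha hb
      refine map_eq_pow_of_mem_lowerCentralSeries hH (fun g => ?_) hv
      let _ : CommGroup (H ⧸ (⊤ : Subgroup H).lowerCentralSeries 1) :=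
        { mul_comm := fun x y => commute_of_mem_last (n := 0)
            (lowerCentralSeries_quotient_eq_bot 1) trivial y }
      let π := QuotientGroup.mk' ((⊤ : Subgroup H).lowerCentralSeries 1)
      have h : (powMonoidHom e).comp (π.comp (FreeGroup.lift ![a, b])) =
          π.comp (FreeGroup.lift ![a', b']) := by
        refine hom_ext_letters ?_ ?_
        · change π (wordEval letterX a b) ^ e = π (wordEval letterX a' b')
          rw [wordEval_letterX, wordEval_letterX, ← map_pow]
          exact QuotientGroup.eq.2 ha
        · change π (wordEval letterY a b) ^ e = π (wordEval letterY a' b')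
          rw [wordEval_letterY, wordEval_letterY, ← map_pow]
          exact QuotientGroup.eq.2 hb
      exact QuotientGroup.eq.1 (DFunLike.congr_fun h g)
    have hcongr : ∀ {a b a' b' : H},
        a⁻¹ * a' ∈ (⊤ : Subgroup H).lowerCentralSeries 1 →
        b⁻¹ * b' ∈ (⊤ : Subgroup H).lowerCentralSeries 1 → wordEval v a' b' = wordEval v a b := by
      intro a b a' b' ha hb
      have h := hgen (e := 1) (a := a) (b := b) (by simpa using ha) (by simpa using hb)
      simpa using h
    have hswap : ∀ a b : H, (b * a)⁻¹ * (a * b) ∈ (⊤ : Subgroup H).lowerCentralSeries 1 := by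
      intro a b
      have h : (b * a)⁻¹ * (a * b) = ⁅a⁻¹, b⁻¹⁆ := by rw [commutatorElement_def]; group
      rw [h]
      exact Subgroup.commutator_mem_commutator trivial trivial
    let _ : CommGroup (Subgroup.center H) :=
      { (inferInstance : Group (Subgroup.center H)) with
        mul_comm := fun a b => Subtype.ext (Subgroup.mem_center_iff.1 b.2 a) }
    let M := Additive (Subgroup.center H)
    let f : H → H → M := fun a b => Additive.ofMul
      ⟨wordEval v a b, Subgroup.mem_center_iff.2 fun c => (hcomm a b c).eq.symm⟩
    have hM : ∀ (n : ℕ) (x : M), n ≠ 0 → n • x = 0 → x = 0 := by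
      intro n x hn hx
      have hx' : ((x.toMul : H)) ^ n = 1 := congrArg (fun y : M => (y.toMul : H)) hx
      obtain ⟨g, hg⟩ := QuotientGroup.mk_surjective (x.toMul : H)
      rw [← hg, ← QuotientGroup.mk_pow, QuotientGroup.eq_one_iff] at hx'
      have hg' := lowerCentralSeries_isIsolated (Fin 2) (m + 1) g n hn hx'
      rw [← QuotientGroup.eq_one_iff, hg] at hg'
      exact Additive.toMul.injective (Subtype.ext hg')
    -- Associativity of w, after the central factors v(a, b) and v(b, c) are dropped from inside the
    -- arguments of v.
    have hf : ∀ a b c, f a b + f (a * b) c = f b c + f a (b * c) := by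
      intro a b c
      refine Additive.toMul.injective (Subtype.ext ?_)
      change wordEval v a b * wordEval v (a * b) c = wordEval v b c * wordEval v a (b * c)
      have h := hassoc a b c
      have mem1 : ∀ a b : H, wordEval v a b ∈ (⊤ : Subgroup H).lowerCentralSeries 1 :=
        fun a b => map_mem_lowerCentralSeries _ hv1
      simp only [wordEval_eq_mul_wordDefect w, ← hvdef] at h
      have e1 : wordEval v (a * b * wordEval v a b) c = wordEval v (a * b) c :=
        hcongr (by rw [inv_mul_cancel_left]; exact mem1 a b) (by simp)
      have e2 : wordEval v a (b * c * wordEval v b c) = wordEval v a (b * c) :=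
        hcongr (by simp) (by rw [inv_mul_cancel_left]; exact mem1 b c)
      rw [e1, e2] at h
      have h' : a * b * c * (wordEval v a b * wordEval v (a * b) c) =
          a * b * c * (wordEval v b c * wordEval v a (b * c)) := by
        rw [← mul_assoc, mul_assoc (a * b), ← (hcomm a b c).eq, ← mul_assoc (a * b), h]
        simp only [mul_assoc]
      exact mul_left_cancel h'
    have hr : ∀ a b c, f a (b * c) = f a (c * b) := fun a b c =>
      Additive.toMul.injective (Subtype.ext (hcongr (by simp) (hswap _ _)))
    have hl : ∀ a b c, f (a * b) c = f (b * a) c := fun a b c =>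
      Additive.toMul.injective (Subtype.ext (hcongr (hswap _ _) (by simp)))
    have hdiag : ∀ a, f a a = 0 := fun a =>
      Additive.toMul.injective (Subtype.ext (wordEval_eq_one_of_commute (Commute.refl a) hv1))
    have hpow : ∀ a b, f (a * a) (b * b) = 2 ^ (m + 1) • f a b := fun a b =>
      Additive.toMul.injective (Subtype.ext (hgen (by simp [pow_two]) (by simp [pow_two])))
    -- Here m ≥ 2 is essential: for m = 1 the factors agree, and the antisymmetric cocycles ⁅a, b⁆ ^
    -- k survive.
    have h4 : 4 < 2 ^ (m + 1) := by
      calc 4 < 2 ^ 3 := by norm_num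
        _ ≤ 2 ^ (m + 1) := Nat.pow_le_pow_right (by norm_num) (by omega)
    have hsymm : ∀ a b, f a b = f b a := by
      intro a b
      have h := cocycle_antisymm_sq hf hr hl a b
      rw [hpow, hpow, ← smul_sub] at h
      exact sub_eq_zero.1 (two_pow_sub_smul_eq_zero hM h4 h)
    have hzero : ∀ a b, f a b = 0 := by
      intro a b
      have h := cocycle_symm_sq hf hr hsymm hdiag a b
      rw [hpow] at h
      exact two_pow_sub_smul_eq_zero hM (by omega) h
    have h := congrArg (fun y : M => (y.toMul : H)) (hzero letterX letterY)
    change wordEval v (letterX : H) (letterY : H) = 1 at h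
    have h3 := map_eq_wordEval (QuotientGroup.mk' N) v
    exact (QuotientGroup.eq_one_iff v).1 (h3.trans h)

/-! ### Operations on groups of class two -/

section ClassTwo

variable {G H : Type} [Group G] [Group H] {t : G → H} {k : ℤ}

theorem commute_commutatorElement (hH : (⊤ : Subgroup H).lowerCentralSeries 2 = ⊥) (a b c : H) :
    Commute ⁅a, b⁆ c :=
  commute_of_mem_last (n := 1) hH (Subgroup.commutator_mem_commutator trivial trivial) c

theorem twisted_mul_of_commute (ht : ∀ a b, t (a * b) = t a * t b * ⁅t a, t b⁆ ^ k) {a b : G}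
    (hab : Commute (t a) (t b)) : t (a * b) = t a * t b := by
  rw [ht, hab.commutator_eq, one_zpow, mul_one]

theorem twisted_one (ht : ∀ a b, t (a * b) = t a * t b * ⁅t a, t b⁆ ^ k) : t 1 = 1 := by
  have h := twisted_mul_of_commute ht (Commute.refl (t 1))
  rw [mul_one] at h
  exact left_eq_mul.1 h

/-- The relation t(a a⁻¹) = 1 exhibits t a⁻¹ as (t a)⁻¹ times a central element, so it commutes with
t a and the twist disappears. -/
theorem twisted_inv (hH : (⊤ : Subgroup H).lowerCentralSeries 2 = ⊥)
    (ht : ∀ a b, t (a * b) = t a * t b * ⁅t a, t b⁆ ^ k) (a : G) : t a⁻¹ = (t a)⁻¹ := by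
  have hcomm : Commute (t a) (t a⁻¹) := by
    have h := ht a a⁻¹
    rw [mul_inv_cancel, twisted_one ht] at h
    have hz : ∀ c, Commute (⁅t a, t a⁻¹⁆ ^ k) c := fun c =>
      (commute_commutatorElement hH _ _ c).zpow_left k
    have h' : t a⁻¹ = (t a)⁻¹ * (⁅t a, t a⁻¹⁆ ^ k)⁻¹ := by
      rw [eq_mul_inv_iff_mul_eq]
      exact eq_inv_of_mul_eq_one_right (by rw [← mul_assoc]; exact h.symm)
    rw [h']
    exact ((Commute.refl _).inv_right).mul_right (hz _).symm.inv_right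
  have h := twisted_mul_of_commute ht hcomm
  rw [mul_inv_cancel, twisted_one ht] at h
  exact (inv_eq_of_mul_eq_one_right h.symm).symm

theorem twisted_mem (ht : ∀ a b, t (a * b) = t a * t b * ⁅t a, t b⁆ ^ k) {g : G}
    (hg : g ∈ (⊤ : Subgroup G).lowerCentralSeries 1) :
    t g ∈ (⊤ : Subgroup H).lowerCentralSeries 1 := by
  let π := QuotientGroup.mk' ((⊤ : Subgroup H).lowerCentralSeries 1)
  let f : G →* H ⧸ (⊤ : Subgroup H).lowerCentralSeries 1 := MonoidHom.mk' (fun g => π (t g)) (by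
    intro a b
    have hmem : ⁅t a, t b⁆ ∈ (⊤ : Subgroup H).lowerCentralSeries 1 :=
      Subgroup.commutator_mem_commutator trivial trivial
    have h : π (⁅t a, t b⁆ ^ k) = 1 := (QuotientGroup.eq_one_iff _).2 (zpow_mem hmem k)
    rw [ht, map_mul, h, mul_one, map_mul])
  exact (QuotientGroup.eq_one_iff _).1
    (map_eq_one_of_mem_lowerCentralSeries f (lowerCentralSeries_quotient_eq_bot 1) hg)

theorem twisted_commute (hH : (⊤ : Subgroup H).lowerCentralSeries 2 = ⊥)
    (ht : ∀ a b, t (a * b) = t a * t b * ⁅t a, t b⁆ ^ k) {g : G}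
    (hg : g ∈ (⊤ : Subgroup G).lowerCentralSeries 1) (c : H) : Commute (t g) c :=
  commute_of_mem_last hH (twisted_mem ht hg) c

/-- Apply t to ab = ⁅a, b⁆ba: interchanging t a and t b costs one commutator, and the twists of ab
and ba contribute k each. -/
theorem twisted_commutatorElement (hH : (⊤ : Subgroup H).lowerCentralSeries 2 = ⊥)
    (ht : ∀ a b, t (a * b) = t a * t b * ⁅t a, t b⁆ ^ k) (a b : G) :
    t ⁅a, b⁆ = ⁅t a, t b⁆ ^ (2 * k + 1) := by
  have hmem : ⁅a, b⁆ ∈ (⊤ : Subgroup G).lowerCentralSeries 1 :=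
    Subgroup.commutator_mem_commutator trivial trivial
  have h := twisted_mul_of_commute ht (twisted_commute hH ht hmem (t (b * a)))
  have e : ⁅a, b⁆ * (b * a) = a * b := by rw [commutatorElement_def]; group
  rw [e, ht, ht b a, ← commutatorElement_inv (t a) (t b), inv_zpow] at h
  have hz := commute_commutatorElement hH (t a) (t b)
  have hxy : t a * t b = ⁅t a, t b⁆ * (t b * t a) := by rw [commutatorElement_def]; group
  rw [← mul_assoc, eq_mul_inv_iff_mul_eq, hxy] at h
  have h3 : ⁅t a, t b⁆ ^ (2 * k + 1) * (t b * t a) = t ⁅a, b⁆ * (t b * t a) := by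
    have hzz : Commute (⁅t a, t b⁆ ^ k * ⁅t a, t b⁆ ^ k) (t b * t a) :=
      ((hz _).zpow_left k).mul_left ((hz _).zpow_left k)
    rw [← h, show 2 * k + 1 = 1 + (k + k) by ring, zpow_one_add, zpow_add, mul_assoc, hzz.eq]
    simp only [mul_assoc]
  exact (mul_right_cancel h3).symm

theorem twisted_eq_one (hH : (⊤ : Subgroup H).lowerCentralSeries 2 = ⊥)
    (ht : ∀ a b, t (a * b) = t a * t b * ⁅t a, t b⁆ ^ k) {g : G}
    (hg : g ∈ (⊤ : Subgroup G).lowerCentralSeries 2) : t g = 1 := by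
  rw [Subgroup.lowerCentralSeries_succ, Subgroup.commutator_def] at hg
  induction hg using Subgroup.closure_induction with
  | mem g hg =>
    obtain ⟨p, hp, q, -, rfl⟩ := hg
    rw [twisted_commutatorElement hH ht, (twisted_commute hH ht hp _).commutator_eq, one_zpow]
  | one => exact twisted_one ht
  | mul a b _ _ iha ihb =>
    rw [twisted_mul_of_commute ht (by rw [iha]; exact Commute.one_left _), iha, ihb, mul_one]
  | inv a _ iha => rw [twisted_inv hH ht, iha, inv_one]

theorem twisted_zpow (hH : (⊤ : Subgroup H).lowerCentralSeries 2 = ⊥)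
    (ht : ∀ a b, t (a * b) = t a * t b * ⁅t a, t b⁆ ^ k) (g : G) (n : ℤ) :
    t (g ^ n) = t g ^ n := by
  have hnat : ∀ n : ℕ, t (g ^ n) = t g ^ n := by
    intro n
    induction n with
    | zero => simp [twisted_one ht]
    | succ n ih =>
      rw [pow_succ, twisted_mul_of_commute ht, ih, pow_succ]
      rw [ih]
      exact (Commute.refl _).pow_left n
  obtain ⟨n, rfl | rfl⟩ := n.eq_nat_or_neg
  · simpa using hnat n
  · simpa [twisted_inv hH ht] using hnat n

end ClassTwo

/-- In class two ⁅x, y⁆ is central; killing the cyclic group it generates makes the letters commute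
and so kills v. -/
theorem exists_zpow_mul_mem {v : FreeGroup (Fin 2)}
    (hv : v ∈ (⊤ : Subgroup (FreeGroup (Fin 2))).lowerCentralSeries 1) :
    ∃ k : ℤ, (⁅letterX, letterY⁆ ^ k)⁻¹ * v ∈
      (⊤ : Subgroup (FreeGroup (Fin 2))).lowerCentralSeries 2 := by
  let π := QuotientGroup.mk' ((⊤ : Subgroup (FreeGroup (Fin 2))).lowerCentralSeries 2)
  have hQ := lowerCentralSeries_quotient_eq_bot (H := FreeGroup (Fin 2)) 2
  let Z := Subgroup.zpowers (π ⁅letterX, letterY⁆)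
  have hc : ∀ c, Commute (π ⁅letterX, letterY⁆) c := by
    intro c
    rw [map_commutatorElement]
    exact commute_commutatorElement hQ _ _ c
  have hZ : Z.Normal := ⟨by
    rintro _ ⟨n, rfl⟩ g
    refine ⟨n, ?_⟩
    change π ⁅letterX, letterY⁆ ^ n = g * π ⁅letterX, letterY⁆ ^ n * g⁻¹
    rw [← ((hc g).zpow_left n).eq, mul_inv_cancel_right]⟩
  have h : (QuotientGroup.mk' Z).comp π v = 1 := by
    refine map_eq_one_of_commute_letters ?_ hv
    rw [← commutatorElement_eq_one_iff_commute, ← map_commutatorElement]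
    exact (QuotientGroup.eq_one_iff _).2 (Subgroup.mem_zpowers _)
  obtain ⟨k, hk⟩ : π v ∈ Z := (QuotientGroup.eq_one_iff _).1 h
  refine ⟨k, QuotientGroup.eq.1 ?_⟩
  exact hk

theorem wordEval_eq_zpow {H : Type} [Group H] (hH : (⊤ : Subgroup H).lowerCentralSeries 2 = ⊥)
    {v : FreeGroup (Fin 2)} {k : ℤ} (hk : (⁅letterX, letterY⁆ ^ k)⁻¹ * v ∈
      (⊤ : Subgroup (FreeGroup (Fin 2))).lowerCentralSeries 2) (a b : H) :
    wordEval v a b = ⁅a, b⁆ ^ k := by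
  have h := map_eq_one_of_mem_lowerCentralSeries (FreeGroup.lift ![a, b]) hH hk
  rw [map_mul, map_inv, map_zpow, map_commutatorElement, inv_mul_eq_one] at h
  rw [wordEval, ← h]
  simp [letterX, letterY]

/-- Witnessed by a rotation and a reflection in the dihedral group of order 8, which has class two.
-/
theorem commutator_letters_notMem : ⁅letterX, letterY⁆ ∉
    (⊤ : Subgroup (FreeGroup (Fin 2))).lowerCentralSeries 2 := by
  intro h
  have hD : (⊤ : Subgroup (DihedralGroup 4)).lowerCentralSeries 2 = ⊥ := by
    refine Subgroup.lowerCentralSeries_succ_eq_bot _ ?_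
    have hc : ∀ a b c : DihedralGroup 4, c * ⁅a, b⁆ = ⁅a, b⁆ * c := by decide
    exact Subgroup.commutator_le.2 fun a _ b _ => Subgroup.mem_center_iff.2 (hc a b)
  have h1 := map_eq_one_of_mem_lowerCentralSeries
    (FreeGroup.lift ![DihedralGroup.r (1 : ZMod 4), DihedralGroup.sr 0]) hD h
  rw [map_commutatorElement] at h1
  simp only [letterX, letterY, FreeGroup.lift_apply_of] at h1
  revert h1
  decide

theorem eq_zero_of_commutator_zpow_mem {n : ℤ} (h : ⁅letterX, letterY⁆ ^ n ∈
    (⊤ : Subgroup (FreeGroup (Fin 2))).lowerCentralSeries 2) : n = 0 := by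
  by_contra hn
  refine commutator_letters_notMem
    (lowerCentralSeries_isIsolated (Fin 2) 2 _ n.natAbs (Int.natAbs_ne_zero.2 hn) ?_)
  obtain ⟨m, rfl | rfl⟩ := n.eq_nat_or_neg
  · simpa using h
  · simpa using h

/-- The word with its letters exchanged. -/
def swapWord (w : FreeGroup (Fin 2)) : FreeGroup (Fin 2) := wordEval w letterY letterX

theorem wordEval_swapWord {H : Type} [Group H] (w : FreeGroup (Fin 2)) (a b : H) :
    wordEval (swapWord w) a b = wordEval w b a := by
  have h := map_wordEval (FreeGroup.lift ![a, b]) w letterY letterX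
  change _ = wordEval w (wordEval letterY a b) (wordEval letterX a b) at h
  rwa [wordEval_letterX, wordEval_letterY] at h

theorem IsAssocWord.swap {d : ℕ} {w : FreeGroup (Fin 2)} (hw : IsAssocWord d w) :
    IsAssocWord d (swapWord w) := by
  intro H _ hH a b c
  simp only [wordEval_swapWord]
  exact (hw H hH c b a).symm

/-- If the operation of a word can be undone by another word, then up to class two it is the
multiplication or the opposite multiplication. -/
theorem wordDefect_mem_or_swapWord {G : Type} [Group G] {w w' : FreeGroup (Fin 2)}
    (hw : wordDefect w ∈ (⊤ : Subgroup (FreeGroup (Fin 2))).lowerCentralSeries 1)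
    (hw' : wordDefect w' ∈ (⊤ : Subgroup (FreeGroup (Fin 2))).lowerCentralSeries 1)
    {t : G → FreeGroup (Fin 2) ⧸ (⊤ : Subgroup (FreeGroup (Fin 2))).lowerCentralSeries 2}
    (ht : ∀ a b, t (a * b) = wordEval w (t a) (t b)) {a b : G} (ha : t a = letterX)
    (hb : t b = letterY) (hab : t (wordEval w' a b) = t a * t b) :
    wordDefect w ∈ (⊤ : Subgroup (FreeGroup (Fin 2))).lowerCentralSeries 2 ∨
      wordDefect (swapWord w) ∈ (⊤ : Subgroup (FreeGroup (Fin 2))).lowerCentralSeries 2 := by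
  have hQ := lowerCentralSeries_quotient_eq_bot (H := FreeGroup (Fin 2)) 2
  obtain ⟨k, hk⟩ := exists_zpow_mul_mem hw
  obtain ⟨k', hk'⟩ := exists_zpow_mul_mem hw'
  have ht' : ∀ a b, t (a * b) = t a * t b * ⁅t a, t b⁆ ^ k := by
    intro a b
    rw [ht, wordEval_eq_mul_wordDefect, wordEval_eq_zpow hQ hk]
  set r := (⁅letterX, letterY⁆ ^ k')⁻¹ * wordDefect w' with hr
  have hr' : wordDefect w' = ⁅letterX, letterY⁆ ^ k' * r := by rw [hr]; group
  have hcomm : wordEval ⁅letterX, letterY⁆ a b = ⁅a, b⁆ := by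
    rw [wordEval, map_commutatorElement]
    simp [letterX, letterY]
  have h1 : wordEval w' a b = a * b * (⁅a, b⁆ ^ k' * wordEval r a b) := by
    rw [wordEval_eq_mul_wordDefect, hr', wordEval_mul, ← hcomm, wordEval, map_zpow]
    rfl
  have hmem : ⁅a, b⁆ ∈ (⊤ : Subgroup G).lowerCentralSeries 1 :=
    Subgroup.commutator_mem_commutator trivial trivial
  have hrmem : wordEval r a b ∈ (⊤ : Subgroup G).lowerCentralSeries 2 :=
    map_mem_lowerCentralSeries _ hk'
  have hrmem1 := Subgroup.lowerCentralSeries_antitone (⊤ : Subgroup G) (by norm_num : 1 ≤ 2) hrmem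
  -- The twist of t contributes k, and each of the k' commutators in w' is sent to a (2k+1)-st
  -- power.
  have h2 : t (wordEval w' a b) = t a * t b * ⁅t a, t b⁆ ^ (k + (2 * k + 1) * k') := by
    rw [h1, twisted_mul_of_commute ht'
        (twisted_commute hQ ht' (mul_mem (zpow_mem hmem k') hrmem1) _).symm,
      twisted_mul_of_commute ht' (twisted_commute hQ ht' hrmem1 _).symm,
      twisted_eq_one hQ ht' hrmem, mul_one, twisted_zpow hQ ht',
      twisted_commutatorElement hQ ht', ht', ← zpow_mul, mul_assoc, ← zpow_add]
  rw [hab, left_eq_mul, ha, hb] at h2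
  have h3 : k + (2 * k + 1) * k' = 0 := by
    refine eq_zero_of_commutator_zpow_mem ((QuotientGroup.eq_one_iff _).1 ?_)
    exact h2
  -- Twice the exponent relation plus 1 factors, so 2k + 1 is a unit of ℤ.
  have h4 : (2 * k + 1) * (2 * k' + 1) = 1 := by linear_combination 2 * h3
  rcases Int.eq_one_or_neg_one_of_mul_eq_one h4 with h5 | h5
  · obtain rfl : k = 0 := by omega
    left
    simpa using hk
  · obtain rfl : k = -1 := by omega
    right
    refine QuotientGroup.eq.1 ?_
    have h6 := map_eq_wordEval
      (QuotientGroup.mk' ((⊤ : Subgroup (FreeGroup (Fin 2))).lowerCentralSeries 2)) (swapWord w)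
    rw [wordEval_swapWord, wordEval_eq_mul_wordDefect, wordEval_eq_zpow hQ hk, zpow_neg_one,
      commutatorElement_inv, ← (commute_commutatorElement hQ _ _ _).eq] at h6
    have h7 : ∀ p q : FreeGroup (Fin 2) ⧸ (⊤ : Subgroup (FreeGroup (Fin 2))).lowerCentralSeries 2,
        p * q = ⁅p, q⁆ * (q * p) := by
      intro p q
      rw [commutatorElement_def]
      group
    exact (h7 _ _).trans h6.symm

/-- An associative unital word operation which can be undone by another word is the
multiplication or the opposite multiplication. -/
theorem wordEval_eq_mul_or_swap {G : Type} [Group G] {d : ℕ} (hd : 2 ≤ d)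
    {w w' : FreeGroup (Fin 2)} (hw : IsUnitalWord d w) (hw' : IsUnitalWord d w')
    (hassoc : IsAssocWord d w)
    {t : G → FreeGroup (Fin 2) ⧸ (⊤ : Subgroup (FreeGroup (Fin 2))).lowerCentralSeries 2}
    (ht : ∀ a b, t (a * b) = wordEval w (t a) (t b)) {a b : G} (ha : t a = letterX)
    (hb : t b = letterY) (hab : t (wordEval w' a b) = t a * t b) :
    (∀ (H : Type) [Group H], (⊤ : Subgroup H).lowerCentralSeries d = ⊥ →
        ∀ a b : H, wordEval w a b = a * b) ∨
      ∀ (H : Type) [Group H], (⊤ : Subgroup H).lowerCentralSeries d = ⊥ →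
        ∀ a b : H, wordEval w a b = b * a := by
  rcases wordDefect_mem_or_swapWord (hw.wordDefect_mem (by omega)) (hw'.wordDefect_mem (by omega))
    ht ha hb hab with h | h
  · exact Or.inl fun H _ hH => wordEval_eq_mul_of_wordDefect_mem
      (hassoc.wordDefect_mem h hd le_rfl) hH
  · refine Or.inr fun H _ hH a b => ?_
    rw [← wordEval_swapWord]
    exact wordEval_eq_mul_of_wordDefect_mem (hassoc.swap.wordDefect_mem h hd le_rfl) hH b a

/-! ### The category of free nilpotent groups -/

namespace FreeNilpotentCat

variable {d : ℕ} {A B D : FreeNilpotentCat d}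

/-- The homomorphism underlying a morphism. -/
def hom (α : A ⟶ B) : A.carrier →* B.carrier := α

/-- The morphism given by a homomorphism. -/
def ofHom (f : A.carrier →* B.carrier) : A ⟶ B := f

@[simp] theorem hom_ofHom (f : A.carrier →* B.carrier) : hom (ofHom f) = f := rfl

@[simp] theorem hom_comp_apply (α : A ⟶ B) (β : B ⟶ D) (a : A.carrier) :
    hom (α ≫ β) a = hom β (hom α a) := rfl

@[simp] theorem hom_id_apply (a : A.carrier) : hom (𝟙 A) a = a := rfl

theorem hom_ext {α β : A ⟶ B} (h : ∀ a, hom α a = hom β a) : α = β :=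
  MonoidHom.ext (f := hom α) (g := hom β) h

/-- The free generators. -/
def gen (i : A.gens) : A.carrier := QuotientGroup.mk (FreeGroup.of i)

theorem lowerCentralSeries_carrier (A : FreeNilpotentCat d) :
    (⊤ : Subgroup A.carrier).lowerCentralSeries d = ⊥ :=
  lowerCentralSeries_quotient_eq_bot d

section Lift

variable {H : Type} [Group H] (hH : (⊤ : Subgroup H).lowerCentralSeries d = ⊥)

/-- The homomorphism with prescribed values on the generators. -/
def liftHom (f : A.gens → H) : A.carrier →* H :=
  QuotientGroup.lift _ (FreeGroup.lift f) fun _ hg =>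
    map_eq_one_of_mem_lowerCentralSeries _ hH hg

@[simp] theorem liftHom_gen (f : A.gens → H) (i : A.gens) : liftHom hH f (gen i) = f i :=
  FreeGroup.lift_apply_of

end Lift

theorem monoidHom_ext {H : Type} [Group H] {f g : A.carrier →* H}
    (h : ∀ i : A.gens, f (gen i) = g (gen i)) : f = g :=
  QuotientGroup.monoidHom_ext _ (FreeGroup.ext_hom _ _ h)

theorem hom_ext_gen {α β : A ⟶ B} (h : ∀ i : A.gens, hom α (gen i) = hom β (gen i)) : α = β :=
  monoidHom_ext (f := hom α) (g := hom β) h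

/-- The morphism with prescribed values on the generators. -/
def lift (f : A.gens → B.carrier) : A ⟶ B := ofHom (liftHom B.lowerCentralSeries_carrier f)

@[simp] theorem hom_lift_gen (f : A.gens → B.carrier) (i : A.gens) :
    hom (lift f) (gen i) = f i :=
  liftHom_gen B.lowerCentralSeries_carrier f i

/-- Homomorphisms to ℤ/2 are determined by arbitrary values on generators; restriction along the
retraction injects those of A into those of B. -/
theorem card_le_of_retract (hd : 1 ≤ d) (h : Retract A B) : A.gens.card ≤ B.gens.card := by
  let H := Multiplicative (ZMod 2)
  have hH : (⊤ : Subgroup H).lowerCentralSeries d = ⊥ := by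
    refine lowerCentralSeries_eq_bot_of_le hd (le_bot_iff.1 (Subgroup.commutator_le.2 ?_))
    intro a _ b _
    exact (Commute.all a b).commutator_eq
  have hinj : Function.Injective fun (u : A.gens → H) (i : B.gens) =>
      liftHom hH u (hom h.r (gen i)) := by
    intro u u' huu
    have h1 : (liftHom hH u).comp (hom h.r) = (liftHom hH u').comp (hom h.r) :=
      monoidHom_ext fun i => congrFun huu i
    funext i
    have h2 := DFunLike.congr_fun h1 (hom h.i (gen i))
    have h3 : hom h.r (hom h.i (gen i)) = gen i := by
      rw [← hom_comp_apply, h.retract, hom_id_apply]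
    simpa [h3] using h2
  have hcard := Fintype.card_le_of_injective _ hinj
  rw [Fintype.card_fun, Fintype.card_fun, Fintype.card_coe, Fintype.card_coe,
    Fintype.card_multiplicative, ZMod.card] at hcard
  exact (Nat.pow_le_pow_iff_right (by norm_num)).1 hcard

open Classical in
theorem nonempty_retract (h : A.gens.card ≤ B.gens.card) : Nonempty (Retract A B) := by
  obtain ⟨e⟩ : Nonempty (A.gens ↪ B.gens) :=
    Function.Embedding.nonempty_of_card_le (by simpa using h)
  refine ⟨⟨lift fun i => gen (e i),
    lift fun j => if hj : ∃ i, e i = j then gen hj.choose else 1, hom_ext_gen fun i => ?_⟩⟩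
  have hi : ∃ i', e i' = e i := ⟨i, rfl⟩
  rw [hom_comp_apply, hom_lift_gen, hom_lift_gen, dif_pos hi, e.injective hi.choose_spec,
    hom_id_apply]

theorem nonempty_iso (h : A.gens.card = B.gens.card) : Nonempty (A ≅ B) := by
  have e : A.gens ≃ B.gens := Finset.equivOfCardEq h
  exact ⟨⟨lift fun i => gen (e i), lift fun j => gen (e.symm j),
    hom_ext_gen fun i => by simp, hom_ext_gen fun i => by simp⟩⟩

/-- The object on `n` standard generators. -/
def std (d n : ℕ) : FreeNilpotentCat d := ⟨Finset.range n⟩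

/-- The standard generators. -/
def stdGen {n : ℕ} (i : ℕ) (hi : i < n) : (std d n).carrier :=
  gen (A := std d n) ⟨i, Finset.mem_range.2 hi⟩

theorem exists_liftHom_std {H : Type} [Group H] (hH : (⊤ : Subgroup H).lowerCentralSeries d = ⊥)
    {n : ℕ} (f : ℕ → H) :
    ∃ φ : (std d n).carrier →* H, ∀ i (hi : i < n), φ (stdGen i hi) = f i :=
  ⟨liftHom hH fun i => f i, fun _ _ => liftHom_gen hH _ _⟩

theorem exists_wordEval_eq (a : (std d 2).carrier) :
    ∃ w, a = wordEval w (stdGen 0 two_pos) (stdGen 1 one_lt_two) := by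
  obtain ⟨u, rfl⟩ := QuotientGroup.mk_surjective a
  let ρ : FreeGroup (std d 2).gens →* FreeGroup (Fin 2) :=
    FreeGroup.lift fun i => FreeGroup.of ⟨i.1, Finset.mem_range.1 i.2⟩
  refine ⟨ρ u, ?_⟩
  have h : QuotientGroup.mk' _ = (FreeGroup.lift ![(stdGen 0 two_pos : (std d 2).carrier),
      stdGen 1 one_lt_two]).comp ρ := by
    refine FreeGroup.ext_hom _ _ ?_
    rintro ⟨i, hi⟩
    simp only [MonoidHom.comp_apply, ρ, FreeGroup.lift_apply_of]
    have hi' := Finset.mem_range.1 hi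
    interval_cases i <;> rfl
  exact DFunLike.congr_fun h u

theorem isUnitalWord_of_carrier {w : FreeGroup (Fin 2)}
    (h : ∀ (A : FreeNilpotentCat d) (a : A.carrier), wordEval w a 1 = a ∧ wordEval w 1 a = a) :
    IsUnitalWord d w := by
  intro H _ hH a
  obtain ⟨φ, hφ⟩ := exists_liftHom_std hH (n := 1) fun _ => a
  have h1 := h _ (stdGen (d := d) 0 one_pos)
  have h2 := congrArg φ h1.1
  have h3 := congrArg φ h1.2
  rw [map_wordEval, hφ, map_one] at h2 h3
  exact ⟨h2, h3⟩

/-- The law on three free generators specializes to every group of class at most d. -/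
theorem isAssocWord_of_carrier {w : FreeGroup (Fin 2)}
    (h : ∀ (A : FreeNilpotentCat d) (a b c : A.carrier),
      wordEval w (wordEval w a b) c = wordEval w a (wordEval w b c)) :
    IsAssocWord d w := by
  intro H _ hH a b c
  obtain ⟨φ, hφ⟩ := exists_liftHom_std hH (n := 3) fun i => if i = 0 then a else if i = 1 then b
    else c
  have h1 := congrArg φ (h _ (stdGen (d := d) (n := 3) 0 (by norm_num)) (stdGen 1 (by norm_num))
    (stdGen 2 (by norm_num)))
  simpa only [map_wordEval, hφ, if_true, one_ne_zero, if_false, OfNat.ofNat_ne_zero,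
    OfNat.ofNat_ne_one] using h1

/-- The elements `x` and `y` freely generate the object. -/
def IsFreeOnPair (B : FreeNilpotentCat d) (x y : B.carrier) : Prop :=
  (∀ (D : FreeNilpotentCat d) (a b : D.carrier), ∃ α : B ⟶ D, hom α x = a ∧ hom α y = b) ∧
    ∀ a : B.carrier, ∃ w, a = wordEval w x y

theorem isFreeOnPair_std :
    IsFreeOnPair (std d 2) (stdGen 0 two_pos) (stdGen 1 one_lt_two) := by
  refine ⟨fun D a b => ?_, exists_wordEval_eq⟩
  obtain ⟨φ, hφ⟩ := exists_liftHom_std D.lowerCentralSeries_carrier (n := 2)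
    fun i => if i = 0 then a else b
  exact ⟨ofHom φ, by simp [hφ], by simp [hφ]⟩

end FreeNilpotentCat

/-! ### Automorphisms of the category: rank, natural bijections, transported multiplication. -/

namespace CatAut

open FreeNilpotentCat

variable {d : ℕ} (Φ : CatAut (FreeNilpotentCat d))

instance : Φ.functor.IsEquivalence := (Cat.equivOfIso Φ).isEquivalence_functor

theorem functor_obj_inv_obj (A : FreeNilpotentCat d) :
    Φ.functor.obj (Φ.inv.toFunctor.obj A) = A := by
  have h : Φ.inv.toFunctor ⋙ Φ.functor = 𝟭 _ := congrArg Cat.Hom.toFunctor Φ.inv_hom_id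
  exact Functor.congr_obj h A

theorem inv_obj_functor_obj (A : FreeNilpotentCat d) :
    Φ.inv.toFunctor.obj (Φ.functor.obj A) = A := by
  have h : Φ.functor ⋙ Φ.inv.toFunctor = 𝟭 _ := congrArg Cat.Hom.toFunctor Φ.hom_inv_id
  exact Functor.congr_obj h A

/-- If the image of a rank n + 1 object had rank at most n, it would be a retract of the image of
the rank n object; full faithfulness would lift this to an impossible retract. -/
theorem le_card_functor_obj (hd : 1 ≤ d) (n : ℕ) : ∀ A : FreeNilpotentCat d, A.gens.card = n →
    n ≤ (Φ.functor.obj A).gens.card := by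
  induction n with
  | zero => exact fun _ _ => Nat.zero_le _
  | succ n ih =>
    intro A hA
    have hcard : (std d n).gens.card = n := Finset.card_range n
    have h1 := ih _ hcard
    obtain ⟨r⟩ := nonempty_retract (A := std d n) (B := A) (by omega)
    have h2 := card_le_of_retract hd (r.map Φ.functor)
    by_contra h3
    obtain ⟨r'⟩ := nonempty_retract (A := Φ.functor.obj A) (B := Φ.functor.obj (std d n)) (by omega)
    have h4 := card_le_of_retract (A := A) (B := std d n) hd
      ⟨Φ.functor.preimage r'.i, Φ.functor.preimage r'.r, Φ.functor.map_injective (by simp)⟩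
    omega

theorem card_functor_obj (hd : 1 ≤ d) (A : FreeNilpotentCat d) :
    (Φ.functor.obj A).gens.card = A.gens.card := by
  refine le_antisymm ?_ (le_card_functor_obj Φ hd _ A rfl)
  have h := le_card_functor_obj Φ⁻¹ hd _ (Φ.functor.obj A) rfl
  have e : (functor Φ⁻¹).obj (Φ.functor.obj A) = A := inv_obj_functor_obj Φ A
  rwa [e] at h

/-- A natural family of bijections from the objects to their images. -/
structure NaturalBijection where
  /-- The bijections. -/
  toEquiv : ∀ A : FreeNilpotentCat d, A.carrier ≃ (Φ.functor.obj A).carrier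
  naturality : ∀ {A B : FreeNilpotentCat d} (α : A ⟶ B) (a : A.carrier),
    hom (Φ.functor.map α) (toEquiv A a) = toEquiv B (hom α a)

/-- Elements of A are morphisms from the rank one object; apply Φ, then precompose with an
isomorphism from that object to its image. -/
theorem nonempty_naturalBijection (hd : 1 ≤ d) : Nonempty Φ.NaturalBijection := by
  obtain ⟨e⟩ := nonempty_iso (card_functor_obj Φ hd (std d 1)).symm
  let g : (std d 1).carrier := stdGen 0 one_pos
  have hext : ∀ {A : FreeNilpotentCat d} {α β : std d 1 ⟶ A}, hom α g = hom β g → α = β := by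
    intro A α β h
    refine hom_ext_gen ?_
    rintro ⟨i, hi⟩
    obtain rfl : i = 0 := by simpa [std] using hi
    exact h
  let pt : ∀ {A : FreeNilpotentCat d}, A.carrier → (std d 1 ⟶ A) := fun a => lift fun _ => a
  have hpt : ∀ {A : FreeNilpotentCat d} (a : A.carrier), hom (pt a) g = a := fun a =>
    hom_lift_gen _ _
  let s : ∀ A : FreeNilpotentCat d, A.carrier → (Φ.functor.obj A).carrier := fun A a =>
    hom (e.hom ≫ Φ.functor.map (pt a)) g
  have hs : ∀ A, Function.Bijective (s A) := by
    intro A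
    constructor
    · intro a b hab
      have h1 := Φ.functor.map_injective ((cancel_epi e.hom).1 (hext hab))
      rw [← hpt a, ← hpt b, h1]
    · intro b
      refine ⟨hom (Φ.functor.preimage (e.inv ≫ pt b)) g, ?_⟩
      have h1 : pt (hom (Φ.functor.preimage (e.inv ≫ pt b)) g) =
          Φ.functor.preimage (e.inv ≫ pt b) := hext (hpt _)
      change hom (e.hom ≫ Φ.functor.map (pt _)) g = b
      rw [h1, Functor.map_preimage, Iso.hom_inv_id_assoc, hpt]
  refine ⟨⟨fun A => Equiv.ofBijective (s A) (hs A), fun {A B} α a => ?_⟩⟩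
  change hom (Φ.functor.map α) (hom (e.hom ≫ Φ.functor.map (pt a)) g) =
    hom (e.hom ≫ Φ.functor.map (pt (hom α a))) g
  have h1 : pt (hom α a) = pt a ≫ α := hext (by rw [hpt, hom_comp_apply, hpt])
  rw [h1, Functor.map_comp, ← Category.assoc, ← hom_comp_apply]

namespace NaturalBijection

variable {Φ} (s : Φ.NaturalBijection)

/-- Naturality along the map from the rank zero object, whose image under Φ is again trivial. -/
theorem map_one (hd : 1 ≤ d) (A : FreeNilpotentCat d) : s.toEquiv A 1 = 1 := by
  have hcard := card_functor_obj Φ hd (std d 0)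
  have hempty : (Φ.functor.obj (std d 0)).gens = ∅ := Finset.card_eq_zero.1 (by rw [hcard]; rfl)
  have htriv : ∀ a : (Φ.functor.obj (std d 0)).carrier, a = 1 := by
    intro a
    have h : MonoidHom.id (Φ.functor.obj (std d 0)).carrier = 1 :=
      monoidHom_ext fun i => (Finset.notMem_empty i.1 (hempty.le i.2)).elim
    exact DFunLike.congr_fun h a
  have h := s.naturality (lift (A := std d 0) (B := A) fun _ => 1) 1
  rw [htriv (s.toEquiv _ 1)] at h
  simpa using h.symm

/-- The transported operation is given by a word. -/
theorem exists_mul_eq : ∃ w, ∀ (A : FreeNilpotentCat d) (a b : A.carrier),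
    s.toEquiv A a * s.toEquiv A b = s.toEquiv A (wordEval w a b) := by
  obtain ⟨h1, h2⟩ := isFreeOnPair_std (d := d)
  -- The word is read off from the generic pair; naturality carries it to every other pair.
  obtain ⟨w, hw⟩ := h2 ((s.toEquiv _).symm (s.toEquiv _ (stdGen 0 two_pos) *
    s.toEquiv _ (stdGen 1 one_lt_two)))
  refine ⟨w, fun A a b => ?_⟩
  obtain ⟨α, rfl, rfl⟩ := h1 A a b
  rw [← map_wordEval, ← hw, ← s.naturality, ← s.naturality, ← s.naturality, ← map_mul,
    Equiv.apply_symm_apply]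

/-- The original operation is a word in the transported operation. -/
theorem exists_map_mul_eq : ∃ w, ∀ (A : FreeNilpotentCat d) (a b : A.carrier),
    s.toEquiv A (a * b) = wordEval w (s.toEquiv A a) (s.toEquiv A b) := by
  obtain ⟨C, x, y, h1, h2⟩ : ∃ (C : FreeNilpotentCat d) (x y : _),
      IsFreeOnPair (Φ.functor.obj C) x y := by
    -- Every object is literally an image under Φ; freeness phrased through a pair of elements can
    -- be moved across this equality.
    refine ⟨Φ.inv.toFunctor.obj (std d 2), ?_⟩
    rw [functor_obj_inv_obj]
    exact ⟨_, _, isFreeOnPair_std⟩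
  obtain ⟨w, hw⟩ := h2 (s.toEquiv C ((s.toEquiv C).symm x * (s.toEquiv C).symm y))
  refine ⟨w, fun A a b => ?_⟩
  obtain ⟨β, hx, hy⟩ := h1 _ (s.toEquiv A a) (s.toEquiv A b)
  obtain ⟨α, rfl⟩ := Φ.functor.map_surjective β
  have hα : ∀ z c, hom (Φ.functor.map α) z = s.toEquiv A c →
      hom α ((s.toEquiv C).symm z) = c := by
    intro z c h
    rw [← (s.toEquiv C).apply_symm_apply z, s.naturality] at h
    exact (s.toEquiv A).injective h
  rw [← hx, ← hy, ← map_wordEval, ← hw, s.naturality, map_mul (hom α), hα _ _ hx, hα _ _ hy]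

/-- A natural family of bijections preserving or reversing the multiplication. -/
theorem mul_or_mul_swap (hd : 2 ≤ d) :
    (∀ A a b, s.toEquiv A (a * b) = s.toEquiv A a * s.toEquiv A b) ∨
      ∀ A a b, s.toEquiv A (a * b) = s.toEquiv A b * s.toEquiv A a := by
  obtain ⟨w, hw⟩ := s.exists_mul_eq
  obtain ⟨w', hw'⟩ := s.exists_map_mul_eq
  have hone := s.map_one (by omega)
  have hunit : IsUnitalWord d w := isUnitalWord_of_carrier fun A a => by
    constructor <;> apply (s.toEquiv A).injective <;> rw [← hw, hone] <;> simp
  have hunit' : IsUnitalWord d w' := isUnitalWord_of_carrier fun B b => by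
    obtain ⟨A, rfl⟩ : ∃ A, Φ.functor.obj A = B := ⟨_, functor_obj_inv_obj Φ B⟩
    obtain ⟨a, rfl⟩ := (s.toEquiv A).surjective b
    rw [← hone A, ← hw', ← hw', mul_one, one_mul]
    exact ⟨rfl, rfl⟩
  have hassoc : IsAssocWord d w := isAssocWord_of_carrier fun A a b c => by
    apply (s.toEquiv A).injective
    rw [← hw, ← hw, ← hw, ← hw, mul_assoc]
  have hQ := lowerCentralSeries_eq_bot_of_le hd
    (lowerCentralSeries_quotient_eq_bot (H := FreeGroup (Fin 2)) 2)
  obtain ⟨φ, hφ⟩ := exists_liftHom_std hQ (n := 2)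
    fun i => if i = 0 then (letterX : FreeGroup (Fin 2) ⧸ _) else letterY
  -- Here t is the inverse bijection followed by projection to class two, so s itself need not
  -- descend to class-two quotients.
  have hdich := wordEval_eq_mul_or_swap hd hunit hunit' hassoc
    (t := fun b => φ ((s.toEquiv (std d 2)).symm b)) (fun a b => by
      rw [← map_wordEval]
      congr 1
      rw [Equiv.symm_apply_eq, ← hw, Equiv.apply_symm_apply, Equiv.apply_symm_apply])
    (a := s.toEquiv _ (stdGen 0 two_pos)) (b := s.toEquiv _ (stdGen 1 one_lt_two))
    (by simp only [Equiv.symm_apply_apply]; exact (hφ 0 _).trans (if_pos rfl))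
    (by simp only [Equiv.symm_apply_apply]; exact (hφ 1 _).trans (if_neg one_ne_zero))
    (by rw [← hw', Equiv.symm_apply_apply, Equiv.symm_apply_apply, Equiv.symm_apply_apply,
      map_mul])
  rcases hdich with h | h
  · refine Or.inl fun A a b => ?_
    rw [hw, h _ A.lowerCentralSeries_carrier]
  · refine Or.inr fun A a b => ?_
    rw [hw, h _ A.lowerCentralSeries_carrier]

/-- A natural family of multiplicative bijections is an isomorphism with the identity. -/
theorem isInner (h : ∀ A a b, s.toEquiv A (a * b) = s.toEquiv A a * s.toEquiv A b) :
    Φ.IsInner := by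
  let m : ∀ A, A.carrier ≃* (Φ.functor.obj A).carrier := fun A => MulEquiv.mk' (s.toEquiv A) (h A)
  refine ⟨fun A => ⟨ofHom (m A).toMonoidHom, ofHom (m A).symm.toMonoidHom,
    hom_ext fun a => (m A).symm_apply_apply a, hom_ext fun a => (m A).apply_symm_apply a⟩,
    fun A B α => hom_ext fun a => s.naturality α a⟩

/-- Composition with inversion. -/
def inv : Φ.NaturalBijection where
  toEquiv A := (s.toEquiv A).trans (Equiv.inv _)
  naturality α a := by
    simp only [Equiv.trans_apply, Equiv.inv_apply, map_inv, s.naturality]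

end NaturalBijection

theorem isInner_of_two_le (hd : 2 ≤ d) : Φ.IsInner := by
  obtain ⟨s⟩ := Φ.nonempty_naturalBijection (by omega)
  rcases s.mul_or_mul_swap hd with h | h
  · exact s.isInner h
  · refine s.inv.isInner fun A a b => ?_
    simp only [NaturalBijection.inv, Equiv.trans_apply, Equiv.inv_apply, h, mul_inv_rev]

end CatAut

/-- For `d ≥ 2`, every automorphism of the category of finitely generated free nilpotent groups of
class at most `d` is inner. -/
theorem theorem1 (d : ℕ) (hd : 2 ≤ d) :
    (∀ Φ : CatAut (FreeNilpotentCat d), Φ.IsInner) ∧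
      CatAut.Inn (FreeNilpotentCat d) = ⊤ :=
  ⟨fun Φ => Φ.isInner_of_two_le hd, eq_top_iff.2 fun Φ _ => Φ.isInner_of_two_le hd⟩
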